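/- **Definitions.** Curves are smooth maps $\gamma: I\to\mathbb R^d$, where $I\subset\mathbb R$ is an interval with nonempty interior. For $k\ge 0$ let $\mathcal Q_k$ be the class of curves for which $\|D^j\gamma\|$ is constant on $I$ for every $j\ge k$. The *horizontal space* of $\gamma\in\mathcal Q_0$ is the linear span of all its derivatives of order $\ge 1$. A *step two stratified Lie algebra on a subspace of $\mathbb R^d$* is a subspace $S=V_1\oplus V_2$ of $\mathbb R^d$ with $V_1\perp V_2$ and $V_2\ne 0$, with a Lie bracket for which $[V_1,V_1]=V_2$ and $[S,V_2]=0$. It is of *contact type* if $\dim V_2=1$. For $0\neq w\in V_2$, its *structure operator* is the skew-symmetric operator $A=A_w$ of $V_1$ with $[x,y]=\langle x,Ay\rangle\,w$ for $x,y\in V_1$, and the *family of curves determined by $(S,w)$* consists of the curves $s\mapsto \exp(sA)v\oplus w$ with $v\in V_1$. We say that $S$ is *determined by* $\gamma\in\mathcal Q_0$ if it is of contact type, $V_1$ is the horizontal space of $\gamma$, and $\gamma$ belongs to the family determined by $(S,w)$ for some $0\ne w\in V_2$. The *Carnot group* of $S$ is $S$ with the product $x\cdot y=x+y+\tfrac12[x,y]$;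 its sub-Riemannian metric is the one for which the left-invariant vector fields $X_i$ of an orthonormal basis of $V_1$ are orthonormal, and the Carnot–Carathéodory distance is the infimum of the lengths of smooth horizontal curves. A *normal geodesic* is a curve which is locally length minimizing for this distance and which is the projection of a solution of Hamilton's equations for $H=\tfrac12\sum_i p(X_i)^2$ on the cotangent bundle. Horizontal projections are orthogonal projections onto $V_1$. **Theorem.** (a) Let $\gamma\in\mathcal Q_0$ be a nonconstant curve in $\mathbb R^d$ which lies in an affine hyperplane not passing through the origin. Then there is exactly one step two stratified Lie algebra of contact type on a subspace of $\mathbb R^d$ which is determined by $\gamma$. Conversely, let $S=V_1\oplus V_2$ be any step two stratified Lie algebra of contact type on a subspace of $\mathbb R^d$ and let $0\ne w\in V_2$. Then $S$ has exactly one structure operator $A_w$, and for every $v\in V_1$ there is exactly one curve $\gamma:\mathbb R\to\mathbb R^d$ of class $\mathcal Q_0$ in the family determined by $(S,w)$ for which the horizontal projection of $\gamma(0)$ is $v$. (b) Let $\mu\in\mathcal Q_1$ be a nonaffine curve in $\mathbb R^d$, defined on the interval $I$, whose velocity $D\mu$ lies in an affine hyperplane not passing through the origin. Then exactly one step two stratified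 Lie algebra $S$ of contact type on a subspace of $\mathbb R^d$ is determined by $D\mu\in\mathcal Q_0$. Moreover, for every $s_0\in I$ there is exactly one germ at $s_0$ of a normal geodesic $c$ of the Carnot group of $S$ such that $c(s_0)$ is the orthogonal projection of $\mu(s_0)$ onto $S$ and the horizontal projections of $\mu$ and $c$ coincide on $I$ near $s_0$. Conversely, let $S=V_1\oplus V_2$ be any step two stratified Lie algebra of contact type on a subspace of $\mathbb R^d$ and let $c$ be the germ at $s_0\in\mathbb R$ of a normal geodesic of its Carnot group. For each $w\in V_2$ there is exactly one curve $\mu_w:\mathbb R\to\mathbb R^d$ in $\mathcal Q_1$ such that $\mu_w(s_0)=c(s_0)$, the horizontal projections of $\mu_w$ and $c$ coincide near $s_0$, and the component of $D\mu_w$ orthogonal to $V_1$ is the constant $w$. If the horizontal projection of $c$ is not affine near $s_0$, then for exactly one of these curves the direction $w$ is nonzero and $D\mu_w$ belongs to the family determined by $(S,w)$. -/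

import Mathlib

open Set Filter Topology MeasureTheory
open scoped ContDiff RealInnerProductSpace ENNReal

noncomputable section

/-! ### Curves all of whose derivatives have constant norm -/

/-- A nondegenerate interval of the real line (open, closed, half-open, bounded or not). -/
def IsInterval (I : Set ℝ) : Prop := I.OrdConnected ∧ (interior I).Nonempty

/-- The class `Q_k`: smooth curves `γ : I → E` such that the norm of the derivative of order `j`
is constant on `I` for every `j ≥ k`. -/
def IsQ {E : Type*} [NormedAddCommGroup E] [NormedSpace ℝ E]
    (k : ℕ) (I : Set ℝ) (γ : ℝ → E) : Prop :=
  ContDiffOn ℝ ∞ γ I ∧ ∀ j, k ≤ j → ∃ r : ℝ, ∀ s ∈ I, ‖iteratedDerivWithin j γ I s‖ = r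

/-- The curve `γ` is constant on `I`. -/
def IsConstantOn {E : Type*} (I : Set ℝ) (γ : ℝ → E) : Prop := ∃ a, ∀ s ∈ I, γ s = a

/-- The curve `γ` is affine on `I`. -/
def IsAffineOn {E : Type*} [NormedAddCommGroup E] [NormedSpace ℝ E]
    (I : Set ℝ) (γ : ℝ → E) : Prop := ∃ a b, ∀ s ∈ I, γ s = a + s • b

/-- The curve `γ` lies in an affine hyperplane that does not pass through the origin. -/
def LiesInHyperplaneOffOrigin {E : Type*} [NormedAddCommGroup E] [InnerProductSpace ℝ E]
    (I : Set ℝ) (γ : ℝ → E) : Prop := ∃ u : E, ∃ k : ℝ, k ≠ 0 ∧ ∀ s ∈ I, ⟪u, γ s⟫ = k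

/-- The horizontal space of a curve of class `Q_0`: the span of its derivatives of positive
order. -/
def horizontalSpace {E : Type*} [NormedAddCommGroup E] [NormedSpace ℝ E]
    (I : Set ℝ) (γ : ℝ → E) : Submodule ℝ E :=
  Submodule.span ℝ {x | ∃ j, 1 ≤ j ∧ ∃ s ∈ I, x = iteratedDerivWithin j γ I s}

/-- The vector `exp(sA) v`. -/
def expFlow {F : Type*} [NormedAddCommGroup F] [NormedSpace ℝ F]
    (A : F →L[ℝ] F) (s : ℝ) (v : F) : F := NormedSpace.exp (s • A) v

/-! ### Step two stratified Lie algebras on subspaces of a Euclidean space -/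

/-- A step two stratified Lie algebra `V₁ ⊕ V₂` on a subspace of the Euclidean space `E`, the
two layers being orthogonal: `[V₁, V₁] = V₂ ≠ 0`, `[V₁, V₂] = [V₂, V₂] = 0`. -/
@[ext]
structure StepTwoAlgebra (E : Type*) [NormedAddCommGroup E] [InnerProductSpace ℝ E] where
  /-- the underlying subspace -/
  carrier : Submodule ℝ E
  /-- the first (horizontal) layer -/
  V₁ : Submodule ℝ E
  /-- the second (vertical) layer -/
  V₂ : Submodule ℝ E
  /-- the Lie bracket -/
  bracket : carrier →ₗ[ℝ] carrier →ₗ[ℝ] carrier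
  sup_eq : V₁ ⊔ V₂ = carrier
  orthogonal : V₁ ⟂ V₂
  V₂_ne_bot : V₂ ≠ ⊥
  bracket_self : ∀ x, bracket x x = 0
  jacobi : ∀ x y z, bracket x (bracket y z) = bracket (bracket x y) z + bracket y (bracket x z)
  bracket_first : Submodule.span ℝ
    {z : E | ∃ x y : carrier, (x : E) ∈ V₁ ∧ (y : E) ∈ V₁ ∧ z = (bracket x y : E)} = V₂
  bracket_second : ∀ x y : carrier, (y : E) ∈ V₂ → bracket x y = 0

namespace StepTwoAlgebra

variable {E : Type*} [NormedAddCommGroup E] [InnerProductSpace ℝ E]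

/-- Contact type: the second layer is one-dimensional. -/
def IsContact (S : StepTwoAlgebra E) : Prop := Module.finrank ℝ S.V₂ = 1

/-- The Lie ring underlying `S`, in the sense of Mathlib. -/
abbrev lieRing (S : StepTwoAlgebra E) : LieRing S.carrier where
  bracket x y := S.bracket x y
  add_lie x y z := by simp
  lie_add x y z := by simp
  lie_self x := S.bracket_self x
  leibniz_lie x y z := S.jacobi x y z

/-- The Lie algebra `S`, in the sense of Mathlib. -/
abbrev lieAlgebra (S : StepTwoAlgebra E) :
    letI := S.lieRing; LieAlgebra ℝ S.carrier :=
  letI := S.lieRing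
  { lie_smul := fun t x y => by simp [Bracket.bracket] }

theorem bracket_neg_swap (S : StepTwoAlgebra E) (x y : S.carrier) :
    S.bracket x y = -S.bracket y x := by
  have h := S.bracket_self (x + y)
  simp only [map_add, LinearMap.add_apply, S.bracket_self, zero_add, add_zero] at h
  exact eq_neg_of_add_eq_zero_right h

theorem bracket_mem (S : StepTwoAlgebra E) (x y : S.carrier) : (S.bracket x y : E) ∈ S.V₂ := by
  have key : ∀ x : S.carrier, ∃ a b : S.carrier, (a : E) ∈ S.V₁ ∧ (b : E) ∈ S.V₂ ∧ x = a + b := by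
    intro x
    have hx : (x : E) ∈ S.V₁ ⊔ S.V₂ := by rw [S.sup_eq]; exact x.2
    obtain ⟨a, ha, b, hb, hab⟩ := Submodule.mem_sup.1 hx
    have le1 : S.V₁ ≤ S.carrier := S.sup_eq ▸ le_sup_left
    have le2 : S.V₂ ≤ S.carrier := S.sup_eq ▸ le_sup_right
    refine ⟨⟨a, le1 ha⟩, ⟨b, le2 hb⟩, ha, hb, ?_⟩
    exact Subtype.ext hab.symm
  obtain ⟨a, b, ha, hb, rfl⟩ := key x
  obtain ⟨a', b', ha', hb', rfl⟩ := key y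
  have h1 : S.bracket b a' = 0 := by rw [bracket_neg_swap, S.bracket_second _ _ hb, neg_zero]
  have h2 : S.bracket (a + b) (a' + b') = S.bracket a a' := by
    simp [S.bracket_second _ _ hb', h1]
  rw [h2, ← S.bracket_first]
  exact Submodule.subset_span ⟨a, a', ha, ha', rfl⟩

/-! ### The Carnot group of a step two stratified Lie algebra -/

/-- The Carnot group of `S` in exponential coordinates: the underlying manifold is the vector
space of `S`, and the product is given by the Baker-Campbell-Hausdorff formula. -/
abbrev group (S : StepTwoAlgebra E) : Group S.carrier where
  mul x y := x + y + (1 / 2 : ℝ) • S.bracket x y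
  one := 0
  inv x := -x
  mul_assoc x y z := by
    have h : ∀ x y z, S.bracket x (S.bracket y z) = 0 := fun x y z =>
      S.bracket_second _ _ (S.bracket_mem y z)
    have h' : ∀ x y z, S.bracket (S.bracket x y) z = 0 := fun x y z => by
      rw [bracket_neg_swap, h, neg_zero]
    change (x + y + (1 / 2 : ℝ) • S.bracket x y) + z +
        (1 / 2 : ℝ) • S.bracket (x + y + (1 / 2 : ℝ) • S.bracket x y) z =
      x + (y + z + (1 / 2 : ℝ) • S.bracket y z) +
        (1 / 2 : ℝ) • S.bracket x (y + z + (1 / 2 : ℝ) • S.bracket y z)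
    simp only [map_add, map_smul, LinearMap.add_apply, LinearMap.smul_apply, h, h', smul_zero,
      add_zero, smul_add]
    abel
  one_mul x := by
    change 0 + x + (1 / 2 : ℝ) • S.bracket 0 x = x
    simp
  mul_one x := by
    change x + 0 + (1 / 2 : ℝ) • S.bracket x 0 = x
    simp
  inv_mul_cancel x := by
    change -x + x + (1 / 2 : ℝ) • S.bracket (-x) x = 0
    simp [S.bracket_self]

/-- The value at `g` of the left-invariant vector field on the Carnot group which is equal
to `X` at the identity. -/
def leftField (S : StepTwoAlgebra E) (X g : S.carrier) : S.carrier :=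
  X + (1 / 2 : ℝ) • S.bracket g X

/-- `leftField` is indeed the field obtained by differentiating left translations at the
identity. -/
theorem leftField_eq (S : StepTwoAlgebra E) (X g : S.carrier) :
    HasDerivAt (fun r : ℝ => S.group.mul g (r • X)) (S.leftField X g) 0 := by
  have h : (fun r : ℝ => S.group.mul g (r • X)) = fun r : ℝ => g + r • S.leftField X g := by
    funext r
    change g + r • X + (1 / 2 : ℝ) • S.bracket g (r • X) = _
    simp only [leftField, map_smul, smul_add, add_assoc, smul_comm r (1 / 2 : ℝ)]
  rw [h]
  simpa using ((hasDerivAt_id (0 : ℝ)).smul_const (S.leftField X g)).const_add g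

/-- An element of the first layer as an element of the Lie algebra. -/
def inclFirst (S : StepTwoAlgebra E) (x : S.V₁) : S.carrier :=
  ⟨x, S.sup_eq ▸ (le_sup_left : S.V₁ ≤ S.V₁ ⊔ S.V₂) x.2⟩

/-! ### The Carnot-Carathéodory metric

The sub-Riemannian metric is the one for which the left-invariant fields of an orthonormal basis
of the first layer `V₁` (for the Euclidean inner product) are orthonormal. -/

/-- Smooth horizontal curves `[a, b] → G`. -/
def IsHorizontalCurve (S : StepTwoAlgebra E) (a b : ℝ) (γ : ℝ → S.carrier) : Prop :=
  ContDiffOn ℝ ∞ γ (Icc a b) ∧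
    ∀ s ∈ Icc a b, ∃ X : S.V₁, derivWithin γ (Icc a b) s = S.leftField (S.inclFirst X) (γ s)

section metric

variable [FiniteDimensional ℝ E]

/-- The sub-Riemannian length of a horizontal curve. The norm of a horizontal vector
`X + [g, X] / 2` at `g` is the Euclidean norm of its component `X` in `V₁`. -/
def length (S : StepTwoAlgebra E) (a b : ℝ) (γ : ℝ → S.carrier) : ℝ :=
  ∫ s in a..b, ‖S.V₁.starProjection ((derivWithin γ (Icc a b) s : S.carrier) : E)‖

/-- The Carnot-Carathéodory distance. -/
def ccDist (S : StepTwoAlgebra E) (P Q : S.carrier) : ℝ≥0∞ :=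
  ⨅ (a : ℝ) (b : ℝ) (γ : ℝ → S.carrier)
    (_ : a < b ∧ S.IsHorizontalCurve a b γ ∧ γ a = P ∧ γ b = Q), ENNReal.ofReal (S.length a b γ)

/-- The curve `c : [a, b] → G` is a sub-Riemannian geodesic: it is horizontal and realizes the
distance between its end points. -/
def IsMinimizing (S : StepTwoAlgebra E) (a b : ℝ) (c : ℝ → S.carrier) : Prop :=
  S.IsHorizontalCurve a b c ∧ ENNReal.ofReal (S.length a b c) = S.ccDist (c a) (c b)

/-- The sub-Riemannian Hamiltonian `½ ∑ p(X_i)²` on `T^*G = G × S^*`. -/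
def hamiltonian (S : StepTwoAlgebra E) (g : S.carrier) (p : S.carrier →L[ℝ] ℝ) : ℝ :=
  1 / 2 * ∑ i, (p (S.leftField (S.inclFirst (stdOrthonormalBasis ℝ S.V₁ i)) g)) ^ 2

/-- Hamilton's equations for the sub-Riemannian Hamiltonian, at the time `s`. -/
def HamiltonEquationsAt (S : StepTwoAlgebra E) (c : ℝ → S.carrier)
    (p : ℝ → (S.carrier →L[ℝ] ℝ)) (s : ℝ) : Prop :=
  DifferentiableAt ℝ c s ∧ DifferentiableAt ℝ p s ∧
    (∀ q : S.carrier →L[ℝ] ℝ,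
      q (deriv c s) = fderiv ℝ (fun p' => S.hamiltonian (c s) p') (p s) q) ∧
    ∀ u : S.carrier, deriv p s u = -fderiv ℝ (fun g => S.hamiltonian g (p s)) (c s) u

/-- The curve `c` is, near the time `s₀`, a normal geodesic of the Carnot group of `S`: it is a
(locally length-minimizing) sub-Riemannian geodesic and the projection to `G` of a
bicharacteristic curve in `T^*G`. This only depends on the germ of `c` at `s₀`. -/
def IsNormalGeodesicAt (S : StepTwoAlgebra E) (c : ℝ → S.carrier) (s₀ : ℝ) : Prop :=
  ∃ ε > 0, (∀ a b, s₀ - ε < a → a < b → b < s₀ + ε → S.IsMinimizing a b c) ∧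
    ∃ p : ℝ → (S.carrier →L[ℝ] ℝ), ∀ s ∈ Ioo (s₀ - ε) (s₀ + ε), S.HamiltonEquationsAt c p s

/-! ### Algebras and curves -/

/-- For a generator `w` of the second layer, `A` is the skew-symmetric operator on `V₁` whose
matrix in an orthonormal basis `X_i` is the structure matrix of `S`: `[X_i, X_j] = a_{ij} w`. -/
def IsStructureOperator (S : StepTwoAlgebra E) (w : E) (A : S.V₁ →L[ℝ] S.V₁) : Prop :=
  (∀ x y : S.V₁, ⟪A x, y⟫ = -⟪x, A y⟫) ∧
    ∀ x y : S.V₁, (S.bracket (S.inclFirst x) (S.inclFirst y) : E) = ⟪x, A y⟫ • w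

/-- The family of curves determined by `S` and a generator `w` of the second layer:
`γ(s) = exp(sA) v ⊕ w` with `v` in the first layer and `A` the structure operator. -/
def InFamily (S : StepTwoAlgebra E) (w : E) (I : Set ℝ) (γ : ℝ → E) : Prop :=
  ∃ A : S.V₁ →L[ℝ] S.V₁, S.IsStructureOperator w A ∧
    ∃ v : S.V₁, ∀ s ∈ I, γ s = ((expFlow A s v : S.V₁) : E) + w

/-- `S` is an algebra of contact type determined by the curve `γ` of class `Q_0`: its first layer
is the horizontal space of `γ`, and `γ(s) = exp(sA) v ⊕ w`, where `w` spans the second layer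
and `A` is the structure operator of `S` with respect to `w`. -/
def IsDeterminedBy (S : StepTwoAlgebra E) (I : Set ℝ) (γ : ℝ → E) : Prop :=
  S.IsContact ∧ S.V₁ = horizontalSpace I γ ∧ ∃ w ∈ S.V₂, w ≠ 0 ∧ S.InFamily w I γ

/-- The curve `μ : ℝ → E` of class `Q_1` starts, at the time `s₀`, at the same point as `c`, has
near `s₀` the same horizontal projection as `c`, and its vertical component is affine with
direction `w`. -/
def IsCompanion (S : StepTwoAlgebra E) (c : ℝ → S.carrier) (s₀ : ℝ) (w : E) (μ : ℝ → E) : Prop :=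
  IsQ 1 univ μ ∧ μ s₀ = c s₀ ∧
    (∀ᶠ s in 𝓝 s₀, S.V₁.starProjection (μ s) = S.V₁.starProjection (c s : E)) ∧
    ∀ s, S.V₁ᗮ.starProjection (deriv μ s) = w

end metric

end StepTwoAlgebra

end

/-!
The theorem rests on one rigidity fact: a curve `γ` of class `Q_0` is an orbit of a one-parameter
group of isometries. Differentiating `‖γ⁽ʲ⁾‖² = const` repeatedly shows that the whole Gram matrix
`⟪γ⁽ⁱ⁾, γ⁽ʲ⁾⟫` is constant. Hence linear relations between the derivatives do not depend on time,
the shift `γ⁽ʲ⁾ ↦ γ⁽ʲ⁺¹⁾` is a well-defined skew-symmetric operator `B` whose range is the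
horizontal space, and `γ' = B γ` (`IsQ.exists_skew_operator`). The part of `γ` orthogonal to the
horizontal space is then a constant vector `w`, nonzero exactly when `γ` lies in a hyperplane off
the origin, and the bracket `[x, y] = ⟪x, B y⟫ w` is the algebra determined by `γ`. It is the only
one, because both `w` and the action of `B` on the derivatives can be read off from `γ`
(`StepTwoAlgebra.eq_of_isDeterminedBy`). Conversely, orbits of isometry groups are of class `Q_0`.

For the second part, let `A` be the structure operator of `w`. A bicharacteristic `(c, p)` has a
conserved vertical momentum `λ = p(w)`, and its horizontal velocity `h` satisfies `h' = -λ A h`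
(`StepTwoAlgebra.IsStructureOperator.exists_velocity`); the vertical component of `c` is obtained
from the horizontal one by a quadrature. So the horizontal projections of normal geodesics are the
primitives of the curves `exp(-sλA) h`, which are the horizontal parts of the curves of class
`Q_1`. The condition that the velocity of a companion belong to the family of `(S, w)` amounts to
`λ = -1`, which normalizes the generator `w` as soon as `A h ≠ 0` and `λ ≠ 0`.

Conversely such a primitive has to be shown to be length minimizing on short intervals
(`length_trajectory_le`). Horizontality makes this a constrained problem in the first layer: among
the curves `ξ` with given end points and given area `∫ ⟪ξ, A ξ'⟫`, the trajectory `x`,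
`x'' = A x'`, is shortest. The energy `∫ ‖ξ'‖²` is compared instead, with the parameter of `x`
changed so that it runs almost proportionally to the arc length of `ξ`. With `η = ξ - x`, the first
variation equals `∫ ⟪η, A η'⟫` by the area constraint, and a Poincaré inequality bounds this by the
second order term `∫ ‖η'‖²` if the interval is shorter than `1 / ‖A‖`.
-/

/-! ### The flow of a linear operator -/

section flow

variable {F : Type*} [NormedAddCommGroup F] [NormedSpace ℝ F]

/-- A curve whose derivative vanishes on an interval is constant there. -/
theorem eq_of_hasDerivWithinAt_zero {f : ℝ → F} {I : Set ℝ} (hI : I.OrdConnected)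
    (hf : ∀ s ∈ I, HasDerivWithinAt f 0 I s) {s t : ℝ} (hs : s ∈ I) (ht : t ∈ I) :
    f s = f t := by
  have h := hI.convex.norm_image_sub_le_of_norm_hasDerivWithin_le (C := 0) hf (by simp) ht hs
  rw [zero_mul, norm_le_zero_iff, sub_eq_zero] at h
  exact h

@[simp] theorem expFlow_zero (A : F →L[ℝ] F) (v : F) : expFlow A 0 v = v := by
  simp [expFlow]

theorem expFlow_add_right (A : F →L[ℝ] F) (s : ℝ) (u v : F) :
    expFlow A s (u + v) = expFlow A s u + expFlow A s v := by
  simp [expFlow]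

variable [CompleteSpace F]

theorem hasDerivAt_expFlow (A : F →L[ℝ] F) (v : F) (s : ℝ) :
    HasDerivAt (fun s => expFlow A s v) (A (expFlow A s v)) s := by
  have h := (hasDerivAt_exp_smul_const' (𝕂 := ℝ) A s)
  exact (h.clm_apply (hasDerivAt_const s v)).congr_deriv (by simp [expFlow])

theorem hasDerivAt_expFlow' (A : F →L[ℝ] F) (v : F) (s : ℝ) :
    HasDerivAt (fun s => expFlow A s v) (expFlow A s (A v)) s := by
  have h := (hasDerivAt_exp_smul_const (𝕂 := ℝ) A s)
  exact (h.clm_apply (hasDerivAt_const s v)).congr_deriv (by simp [expFlow])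

theorem apply_expFlow (A : F →L[ℝ] F) (v : F) (s : ℝ) :
    A (expFlow A s v) = expFlow A s (A v) :=
  (hasDerivAt_expFlow A v s).unique (hasDerivAt_expFlow' A v s)

theorem expFlow_add (A : F →L[ℝ] F) (s t : ℝ) (v : F) :
    expFlow A (s + t) v = expFlow A s (expFlow A t v) := by
  let _ : NormedAlgebra ℚ (F →L[ℝ] F) := NormedAlgebra.restrictScalars ℚ ℝ _
  have h : NormedSpace.exp ((s + t) • A) = NormedSpace.exp (s • A) * NormedSpace.exp (t • A) := by
    rw [add_smul]
    exact NormedSpace.exp_add_of_commute (((Commute.refl A).smul_left s).smul_right t)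
  simp only [expFlow, h, mul_apply_eq_comp]

theorem expFlow_neg_expFlow (A : F →L[ℝ] F) (s : ℝ) (v : F) :
    expFlow A (-s) (expFlow A s v) = v := by
  rw [← expFlow_add, neg_add_cancel, expFlow_zero]

/-- Solutions of the linear equation `f' = A f` on an interval are given by the flow of `A`. -/
theorem eq_expFlow_of_hasDerivWithinAt (A : F →L[ℝ] F) {f : ℝ → F} {I : Set ℝ}
    (hI : I.OrdConnected) (hf : ∀ s ∈ I, HasDerivWithinAt f (A (f s)) I s) {s₀ s : ℝ}
    (hs₀ : s₀ ∈ I) (hs : s ∈ I) : f s = expFlow A (s - s₀) (f s₀) := by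
  have key : ∀ r ∈ I, HasDerivWithinAt (fun r => expFlow A (s₀ - r) (f r)) 0 I r := by
    intro r hr
    have h1 : HasDerivAt (fun r : ℝ => NormedSpace.exp ((s₀ - r) • A))
        (-(NormedSpace.exp ((s₀ - r) • A) * A)) r := by
      have := (hasDerivAt_exp_smul_const (𝕂 := ℝ) A (s₀ - r)).scomp r
        ((hasDerivAt_id r).const_sub s₀)
      simpa [Function.comp_def] using this
    refine (h1.hasDerivWithinAt.clm_apply (hf r hr)).congr_deriv ?_
    simp
  have h := eq_of_hasDerivWithinAt_zero hI key hs hs₀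
  simp only [sub_self, expFlow_zero] at h
  rw [← h, ← expFlow_add]
  simp

theorem expFlow_of_apply_eq_zero (A : F →L[ℝ] F) {w : F} (hw : A w = 0) (s : ℝ) :
    expFlow A s w = w := by
  have h := eq_expFlow_of_hasDerivWithinAt A (f := fun _ => w) (I := univ) ordConnected_univ
    (fun s _ => by simpa [hw] using hasDerivWithinAt_const s univ w) (mem_univ 0) (mem_univ s)
  simpa using h.symm

theorem deriv_expFlow (A : F →L[ℝ] F) (v : F) :
    deriv (fun s => expFlow A s v) = fun s => expFlow A s (A v) :=
  funext fun s => (hasDerivAt_expFlow' A v s).deriv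

theorem iteratedDeriv_expFlow (A : F →L[ℝ] F) (v : F) (j : ℕ) :
    iteratedDeriv j (fun s => expFlow A s v) = fun s => expFlow A s ((A ^ j) v) := by
  induction j generalizing v with
  | zero => simp [iteratedDeriv_zero]
  | succ j ih =>
    rw [iteratedDeriv_succ', deriv_expFlow, ih]
    simp [pow_succ]

theorem contDiff_expFlow (A : F →L[ℝ] F) (v : F) : ContDiff ℝ ∞ (fun s => expFlow A s v) := by
  rw [contDiff_infty]
  intro n
  induction n generalizing v with
  | zero =>
    exact contDiff_zero.2
      (continuous_iff_continuousAt.2 fun s => (hasDerivAt_expFlow A v s).continuousAt)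
  | succ n ih =>
    push_cast
    rw [contDiff_succ_iff_deriv]
    refine ⟨fun s => (hasDerivAt_expFlow A v s).differentiableAt, by simp, ?_⟩
    rw [deriv_expFlow]
    exact ih _

end flow

section intertwining

variable {F G : Type*} [NormedAddCommGroup F] [NormedSpace ℝ F] [CompleteSpace F]
  [NormedAddCommGroup G] [NormedSpace ℝ G] [CompleteSpace G]

theorem map_expFlow (L : F →L[ℝ] G) {A : F →L[ℝ] F} {B : G →L[ℝ] G}
    (h : ∀ v, L (A v) = B (L v)) (s : ℝ) (v : F) : L (expFlow A s v) = expFlow B s (L v) := by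
  have := eq_expFlow_of_hasDerivWithinAt B (f := fun s => L (expFlow A s v)) (I := univ)
    ordConnected_univ (fun s _ => by
      rw [← h]; exact (L.hasFDerivAt.comp_hasDerivAt s (hasDerivAt_expFlow A v s)).hasDerivWithinAt)
    (mem_univ 0) (mem_univ s)
  simpa [Function.comp_def] using this

end intertwining

section skew

variable {F : Type*} [NormedAddCommGroup F] [InnerProductSpace ℝ F]

theorem inner_self_eq_zero_of_skew {A : F →L[ℝ] F} (hA : ∀ x y, ⟪A x, y⟫ = -⟪x, A y⟫) (x : F) :
    ⟪x, A x⟫ = 0 := by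
  have h := hA x x
  rw [real_inner_comm] at h
  linarith

theorem apply_eq_zero_of_skew {A : F →L[ℝ] F} (hA : ∀ x y, ⟪A x, y⟫ = -⟪x, A y⟫) {x : F}
    (hx : A (A x) = 0) : A x = 0 := by
  rw [← inner_self_eq_zero (𝕜 := ℝ), hA, hx, inner_zero_right, neg_zero]

variable [CompleteSpace F]

theorem norm_expFlow {A : F →L[ℝ] F} (hA : ∀ x y, ⟪A x, y⟫ = -⟪x, A y⟫) (s : ℝ) (v : F) :
    ‖expFlow A s v‖ = ‖v‖ := by
  have key : ∀ r ∈ (univ : Set ℝ),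
      HasDerivWithinAt (fun r => ⟪expFlow A r v, expFlow A r v⟫) 0 univ r := by
    intro r _
    have h := hasDerivAt_expFlow A v r
    refine (h.inner ℝ h).hasDerivWithinAt.congr_deriv ?_
    rw [real_inner_comm (expFlow A r v) (A _), inner_self_eq_zero_of_skew hA, add_zero]
  have h := eq_of_hasDerivWithinAt_zero ordConnected_univ key (mem_univ s) (mem_univ 0)
  simp only [expFlow_zero, real_inner_self_eq_norm_sq] at h
  exact (sq_eq_sq₀ (norm_nonneg _) (norm_nonneg _)).1 h

/-- The orbits of a one-parameter group of isometries are curves of class `Q_0`. -/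
theorem isQ_expFlow {A : F →L[ℝ] F} (hA : ∀ x y, ⟪A x, y⟫ = -⟪x, A y⟫) (v : F) :
    IsQ 0 univ (fun s => expFlow A s v) := by
  refine ⟨(contDiff_expFlow A v).contDiffOn, fun j _ => ⟨‖(A ^ j) v‖, fun s _ => ?_⟩⟩
  rw [iteratedDerivWithin_univ, iteratedDeriv_expFlow]
  exact norm_expFlow hA s _

end skew

/-! ### Curves of class `Q_0` are orbits of isometry groups -/

section structureTheorem

variable {E : Type*} [NormedAddCommGroup E] [InnerProductSpace ℝ E]

/-- The Gram matrix of a sequence of successive derivatives of constant norms is constant. -/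
theorem inner_const_of_norm_const {I : Set ℝ} (hI : I.OrdConnected) (g : ℕ → ℝ → E)
    (hg : ∀ j, ∀ s ∈ I, HasDerivWithinAt (g j) (g (j + 1) s) I s)
    (hn : ∀ j, ∀ s ∈ I, ∀ t ∈ I, ‖g j s‖ = ‖g j t‖) (i j : ℕ) :
    ∀ s ∈ I, ∀ t ∈ I, ⟪g i s, g j s⟫ = ⟪g i t, g j t⟫ := by
  have main : ∀ k, ∀ i, ∀ s ∈ I, ∀ t ∈ I, ⟪g i s, g (i + k) s⟫ = ⟪g i t, g (i + k) t⟫ := by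
    intro k
    induction k using Nat.strong_induction_on with
    | _ k ih =>
      -- for a subsingleton interval all claims are trivial; otherwise derivatives are unique
      by_cases hsub : I.Subsingleton
      · intro i s hs t ht
        rw [hsub hs ht]
      have huniq : ∀ s ∈ I, UniqueDiffWithinAt ℝ I s := by
        have hint : (interior I).Nonempty := by
          obtain ⟨a, ha, b, hb, hab⟩ := not_subsingleton_iff.1 hsub
          rcases lt_or_gt_of_ne hab with h | h
          · exact (nonempty_Ioo.2 h).mono
              (interior_maximal (Ioo_subset_Icc_self.trans (hI.out ha hb)) isOpen_Ioo)
          · exact (nonempty_Ioo.2 h).mono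
              (interior_maximal (Ioo_subset_Icc_self.trans (hI.out hb ha)) isOpen_Ioo)
        exact uniqueDiffOn_convex hI.convex hint
      have hder : ∀ m, m < k → ∀ i, ∀ s ∈ I,
          ⟪g i s, g (i + m + 1) s⟫ + ⟪g (i + 1) s, g (i + m) s⟫ = 0 := by
        intro m hm i s hs
        have h1 := ((hg i s hs).inner ℝ (hg (i + m) s hs))
        have h2 : HasDerivWithinAt (fun t => ⟪g i t, g (i + m) t⟫) 0 I s :=
          (hasDerivWithinAt_const s I ⟪g i s, g (i + m) s⟫).congr
            (fun t ht => ih m hm i t ht s hs) rfl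
        exact (huniq s hs).eq_deriv _ h1 h2
      intro i s hs t ht
      match k, ih, hder with
      | 0, _, _ => simp [hn i s hs t ht]
      | 1, _, hder =>
        have h1 := hder 0 zero_lt_one i s hs
        have h2 := hder 0 zero_lt_one i t ht
        simp only [add_zero, real_inner_comm (g i _) (g (i + 1) _)] at h1 h2
        linarith
      | k + 2, ih, hder =>
        have h1 := hder (k + 1) (by lia) i s hs
        have h2 := hder (k + 1) (by lia) i t ht
        have h3 := ih k (by lia) (i + 1) s hs t ht
        rw [show i + 1 + k = i + (k + 1) by ring] at h3
        rw [show i + (k + 2) = i + (k + 1) + 1 by ring]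
        linarith
  intro s hs t ht
  rcases le_total i j with h | h
  · obtain ⟨k, rfl⟩ := Nat.exists_eq_add_of_le h
    exact main k i s hs t ht
  · obtain ⟨k, rfl⟩ := Nat.exists_eq_add_of_le h
    rw [real_inner_comm, main k j s hs t ht, real_inner_comm]

variable [FiniteDimensional ℝ E]

/-- The derivatives of a curve with constant Gram matrix are generated by a skew-symmetric
operator. For a finitely supported `f : ℕ → ℝ` put `Φ s f = ∑ f j • g j s`. The kernel of `Φ s`
does not depend on `s`, so that the shift of the index induces the operator `B` on the range of
`Φ s₀`, and `U s = Φ s ∘ (Φ s₀)⁻¹` satisfies `U' = U B`. -/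
theorem exists_skew_operator {I : Set ℝ} (hI : IsInterval I) (g : ℕ → ℝ → E)
    (hg : ∀ j, ∀ s ∈ I, HasDerivWithinAt (g j) (g (j + 1) s) I s)
    (hn : ∀ j, ∀ s ∈ I, ∀ t ∈ I, ‖g j s‖ = ‖g j t‖) :
    ∃ B : E →L[ℝ] E, (∀ x y, ⟪B x, y⟫ = -⟪x, B y⟫) ∧
      (∀ j, ∀ s ∈ I, g (j + 1) s = B (g j s)) ∧
      ∀ x, B x ∈ Submodule.span ℝ {x | ∃ j, 1 ≤ j ∧ ∃ s ∈ I, x = g j s} := by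
  have : CompleteSpace E := FiniteDimensional.complete ℝ E
  have huniq : ∀ s ∈ I, UniqueDiffWithinAt ℝ I s := uniqueDiffOn_convex hI.1.convex hI.2
  obtain ⟨s₀, hs₀⟩ : I.Nonempty := hI.2.mono interior_subset
  have hgram := inner_const_of_norm_const hI.1 g hg hn
  set Φ : ℝ → (ℕ →₀ ℝ) →ₗ[ℝ] E := fun s => Finsupp.linearCombination ℝ (fun j => g j s) with hΦ
  set σ : (ℕ →₀ ℝ) →ₗ[ℝ] (ℕ →₀ ℝ) := Finsupp.lmapDomain ℝ ℝ Nat.succ with hσ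
  have hΦsingle : ∀ s j (r : ℝ), Φ s (Finsupp.single j r) = r • g j s := by
    intro s j r; simp [hΦ]
  have hσsingle : ∀ j (r : ℝ), σ (Finsupp.single j r) = Finsupp.single (j + 1) r := by
    intro j r; simp [hσ]
  have hΦder : ∀ f, ∀ s ∈ I, HasDerivWithinAt (fun s => Φ s f) (Φ s (σ f)) I s := by
    intro f s hs
    induction f using Finsupp.induction_linear with
    | zero => simpa using hasDerivWithinAt_const s I (0 : E)
    | add f f' hf hf' => simpa using hf.fun_add hf'
    | single j r => simpa [hΦsingle, hσsingle] using (hg j s hs).fun_const_smul r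
  have hΦgram : ∀ f f', ∀ s ∈ I, ⟪Φ s f, Φ s f'⟫ = ⟪Φ s₀ f, Φ s₀ f'⟫ := by
    intro f f' s hs
    induction f using Finsupp.induction_linear with
    | zero => simp
    | add f₁ f₂ h₁ h₂ => simp [inner_add_left, h₁, h₂]
    | single i r =>
      induction f' using Finsupp.induction_linear with
      | zero => simp
      | add f₁ f₂ h₁ h₂ => simp only [map_add, inner_add_right, h₁, h₂]
      | single j r' =>
        simp only [hΦsingle, inner_smul_left, inner_smul_right, hgram i j s hs s₀ hs₀]
  have hΦskew : ∀ f f', ⟪Φ s₀ (σ f), Φ s₀ f'⟫ = -⟪Φ s₀ f, Φ s₀ (σ f')⟫ := by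
    intro f f'
    have h1 := (hΦder f s₀ hs₀).inner ℝ (hΦder f' s₀ hs₀)
    have h2 : HasDerivWithinAt (fun t => ⟪Φ t f, Φ t f'⟫) 0 I s₀ :=
      (hasDerivWithinAt_const s₀ I ⟪Φ s₀ f, Φ s₀ f'⟫).congr
        (fun t ht => hΦgram f f' t ht) rfl
    have h3 := (huniq s₀ hs₀).eq_deriv _ h1 h2
    linarith
  have hker : ∀ f f', Φ s₀ f = Φ s₀ f' → ∀ s ∈ I, Φ s f = Φ s f' := by
    intro f f' h s hs
    rw [← sub_eq_zero, ← map_sub, ← inner_self_eq_zero (𝕜 := ℝ), hΦgram _ _ s hs, map_sub, h,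
      sub_self, inner_zero_left]
  -- the kernel of `Φ s₀` is invariant under the shift, by skew-symmetry
  have hkerσ : ∀ f f', Φ s₀ f = Φ s₀ f' → Φ s₀ (σ f) = Φ s₀ (σ f') := by
    intro f f' h
    rw [← sub_eq_zero, ← map_sub, ← map_sub, ← inner_self_eq_zero (𝕜 := ℝ), hΦskew, map_sub (Φ s₀),
      h, sub_self, inner_zero_left, neg_zero]
  set W := LinearMap.range (Φ s₀) with hW
  obtain ⟨R₀, hR₀⟩ := LinearMap.exists_rightInverse_of_surjective (Φ s₀).rangeRestrict
    (Φ s₀).range_rangeRestrict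
  set P : E →ₗ[ℝ] W := W.orthogonalProjectionOnto.toLinearMap with hP
  have hPW : ∀ x ∈ W, ((P x : W) : E) = x := fun x hx =>
    Submodule.starProjection_eq_self_iff.2 hx
  have hPinner : ∀ x y, y ∈ W → ⟪((P x : W) : E), y⟫ = ⟪x, y⟫ := by
    intro x y hy
    have h := W.starProjection_inner_eq_zero x y hy
    rw [inner_sub_left, sub_eq_zero] at h
    exact h.symm
  set R : E →ₗ[ℝ] (ℕ →₀ ℝ) := R₀ ∘ₗ P with hR
  have hΦR : ∀ x, Φ s₀ (R x) = P x := by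
    intro x
    have h := congrArg (fun L : W →ₗ[ℝ] W => ((L (P x) : W) : E)) hR₀
    simpa [hR] using h
  have hΦRΦ : ∀ f, Φ s₀ (R (Φ s₀ f)) = Φ s₀ f := fun f => by
    rw [hΦR, hPW _ ⟨f, rfl⟩]
  set B : E →L[ℝ] E := (Φ s₀ ∘ₗ σ ∘ₗ R).toContinuousLinearMap with hB
  have hBx : ∀ x, B x = Φ s₀ (σ (R x)) := fun x => rfl
  have hBΦ : ∀ f, B (Φ s₀ f) = Φ s₀ (σ f) := fun f => by rw [hBx, hkerσ _ _ (hΦRΦ f)]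
  have hBW : ∀ x, B x ∈ W := fun x => ⟨_, (hBx x).symm⟩
  have hBP : ∀ x, B (P x) = B x := fun x => by rw [← hΦR, hBΦ, hBx]
  have hskew : ∀ x y, ⟪B x, y⟫ = -⟪x, B y⟫ := by
    intro x y
    rw [real_inner_comm, ← hPinner y _ (hBW x), real_inner_comm, ← hPinner x _ (hBW y), hBx, hBx,
      ← hΦR, ← hΦR, hΦskew]
  -- `U s = Φ s ∘ R` satisfies `U' = U B`
  have hUder : ∀ x, ∀ s ∈ I, HasDerivWithinAt (fun s => Φ s (R x)) (Φ s (R (B x))) I s := by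
    intro x s hs
    refine (hΦder (R x) s hs).congr_deriv ?_
    refine hker _ _ ?_ s hs
    rw [hΦR, hPW _ (hBW x), hBx]
  have hUconst : ∀ x, ∀ s ∈ I, Φ s (R (expFlow B (s₀ - s) x)) = P x := by
    intro x s hs
    set b := stdOrthonormalBasis ℝ E with hb
    have hexp : ∀ s y, Φ s (R y) = ∑ i, ⟪b i, y⟫ • Φ s (R (b i)) := by
      intro s y
      conv_lhs => rw [← b.sum_repr' y]
      simp
    have hderiv : ∀ r ∈ I, HasDerivWithinAt (fun r => Φ r (R (expFlow B (s₀ - r) x))) 0 I r := by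
      intro r hr
      have h1 : HasDerivWithinAt (fun r => expFlow B (s₀ - r) x) (-B (expFlow B (s₀ - r) x)) I r := by
        have := (hasDerivAt_expFlow B x (s₀ - r)).scomp r ((hasDerivAt_id r).const_sub s₀)
        simpa [Function.comp_def] using this.hasDerivWithinAt
      have h2 := HasDerivWithinAt.fun_sum (u := Finset.univ) fun i _ =>
        ((hasDerivWithinAt_const r I (b i)).inner ℝ h1).smul (hUder (b i) r hr)
      have h3 : (fun r => Φ r (R (expFlow B (s₀ - r) x))) =
          fun r => ∑ i, ⟪b i, expFlow B (s₀ - r) x⟫ • Φ r (R (b i)) := funext fun r => hexp r _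
      rw [h3]
      refine h2.congr_deriv ?_
      rw [Finset.sum_add_distrib]
      have h4 : ∑ i, ⟪b i, expFlow B (s₀ - r) x⟫ • Φ r (R (B (b i))) =
          Φ r (R (B (expFlow B (s₀ - r) x))) := by
        conv_rhs => rw [← b.sum_repr' (expFlow B (s₀ - r) x)]
        simp
      rw [h4, hexp r (B _)]
      simp [inner_neg_right]
    rw [eq_of_hasDerivWithinAt_zero hI.1 hderiv hs hs₀]
    simp [hΦR]
  have hgP : ∀ j, ∀ s ∈ I, g j s = P (expFlow B (s - s₀) (g j s₀)) := by
    intro j s hs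
    have h := hUconst (expFlow B (s - s₀) (g j s₀)) s hs
    rw [← neg_sub s s₀, expFlow_neg_expFlow] at h
    rw [← h, ← one_smul ℝ (g j s), ← hΦsingle]
    refine hker _ _ ?_ s hs
    rw [hΦR, hPW _ ⟨Finsupp.single j 1, by simp [hΦsingle]⟩, hΦsingle, one_smul]
  refine ⟨B, hskew, fun j s hs => ?_, fun x => ?_⟩
  · have h1 : g (j + 1) s₀ = B (g j s₀) := by
      rw [← one_smul ℝ (g j s₀), ← hΦsingle, hBΦ, hσsingle, hΦsingle, one_smul]
    rw [hgP (j + 1) s hs, hgP j s hs, hBP, h1, ← apply_expFlow, hPW _ (hBW _)]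
  · rw [hBx]
    generalize R x = f
    induction f using Finsupp.induction_linear with
    | zero => simp
    | add f f' hf hf' =>
      rw [map_add, map_add]
      exact add_mem hf hf'
    | single j r =>
      rw [hσsingle, hΦsingle]
      exact Submodule.smul_mem _ _ (Submodule.subset_span ⟨j + 1, by lia, s₀, hs₀, rfl⟩)

/-- Structure theorem for the class `Q_0`: such a curve is an orbit of a one-parameter group of
isometries, whose generator may be chosen to map onto the horizontal space. -/
theorem IsQ.exists_skew_operator {I : Set ℝ} (hI : IsInterval I) {γ : ℝ → E} (hγ : IsQ 0 I γ) :
    ∃ B : E →L[ℝ] E, (∀ x y, ⟪B x, y⟫ = -⟪x, B y⟫) ∧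
      (∀ j, ∀ s ∈ I, iteratedDerivWithin (j + 1) γ I s = B (iteratedDerivWithin j γ I s)) ∧
      ∀ x, B x ∈ horizontalSpace I γ := by
  have hU : UniqueDiffOn ℝ I := uniqueDiffOn_convex hI.1.convex hI.2
  refine _root_.exists_skew_operator hI (fun j => iteratedDerivWithin j γ I) (fun j s hs => ?_)
    fun j s hs t ht => ?_
  · have h := hγ.1.differentiableOn_iteratedDerivWithin (m := j)
      (by exact_mod_cast WithTop.coe_lt_top j) hU
    rw [iteratedDerivWithin_succ]
    exact (h s hs).hasDerivWithinAt
  · obtain ⟨r, hr⟩ := hγ.2 j (Nat.zero_le j)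
    rw [hr s hs, hr t ht]

end structureTheorem

/-! ### Algebras of contact type and their structure operators -/

theorem IsInterval.uniqueDiffOn {I : Set ℝ} (hI : IsInterval I) : UniqueDiffOn ℝ I :=
  uniqueDiffOn_convex hI.1.convex hI.2

theorem isInterval_univ : IsInterval univ := ⟨ordConnected_univ, by simp⟩

theorem iteratedDerivWithin_eq_expFlow {F : Type*} [NormedAddCommGroup F] [NormedSpace ℝ F]
    [CompleteSpace F] {B : F →L[ℝ] F} {u : F} {I : Set ℝ} (hI : IsInterval I) {γ : ℝ → F}
    (h : ∀ s ∈ I, γ s = expFlow B s u) (j : ℕ) {s : ℝ} (hs : s ∈ I) :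
    iteratedDerivWithin j γ I s = expFlow B s ((B ^ j) u) := by
  rw [iteratedDerivWithin_congr (fun s hs => h s hs) hs,
    iteratedDerivWithin_eq_iteratedDeriv hI.uniqueDiffOn
      ((contDiff_expFlow B u).of_le (mod_cast le_top)).contDiffAt hs, iteratedDeriv_expFlow]

namespace StepTwoAlgebra

variable {E : Type*} [NormedAddCommGroup E] [InnerProductSpace ℝ E]

theorem V₁_le (S : StepTwoAlgebra E) : S.V₁ ≤ S.carrier := S.sup_eq ▸ le_sup_left

theorem V₂_le (S : StepTwoAlgebra E) : S.V₂ ≤ S.carrier := S.sup_eq ▸ le_sup_right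

@[simp] theorem coe_inclFirst (S : StepTwoAlgebra E) (x : S.V₁) : (S.inclFirst x : E) = x := rfl

theorem inclFirst_add (S : StepTwoAlgebra E) (x y : S.V₁) :
    S.inclFirst (x + y) = S.inclFirst x + S.inclFirst y := rfl

theorem inclFirst_smul (S : StepTwoAlgebra E) (r : ℝ) (x : S.V₁) :
    S.inclFirst (r • x) = r • S.inclFirst x := rfl

theorem inner_eq_zero (S : StepTwoAlgebra E) {x y : E} (hx : x ∈ S.V₁) (hy : y ∈ S.V₂) :
    ⟪x, y⟫ = 0 :=
  (Submodule.isOrtho_iff_inner_eq.1 S.orthogonal) x hx y hy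

theorem V₂_eq_span {S : StepTwoAlgebra E} (hS : S.IsContact) {w : E} (hw : w ∈ S.V₂)
    (hw0 : w ≠ 0) : S.V₂ = Submodule.span ℝ {w} := by
  have : FiniteDimensional ℝ S.V₂ := FiniteDimensional.of_finrank_pos (by rw [hS]; exact one_pos)
  refine (Submodule.eq_of_le_of_finrank_eq ?_ ?_).symm
  · rwa [Submodule.span_singleton_le_iff_mem]
  · rw [finrank_span_singleton hw0, hS]

/-- Two algebras with the same layers and the same bracket formula are equal. -/
theorem eq_of_bracket_eq {S S' : StepTwoAlgebra E} (h₁ : S.V₁ = S'.V₁) (h₂ : S.V₂ = S'.V₂)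
    {β : E → E → E} (hS : ∀ x y, (S.bracket x y : E) = β x y)
    (hS' : ∀ x y, (S'.bracket x y : E) = β x y) : S = S' := by
  have h₀ : S.carrier = S'.carrier := by rw [← S.sup_eq, ← S'.sup_eq, h₁, h₂]
  cases S
  cases S'
  subst h₀ h₁ h₂
  congr 1
  ext x y
  rw [hS, hS']

/-- The bracket `[x, y] = ⟪x, B y⟫ w` on `V ⊔ ℝ w`. -/
noncomputable def contactBracket (V : Submodule ℝ E) (w : E) (B : E →L[ℝ] E) :
    ↥(V ⊔ Submodule.span ℝ {w}) →ₗ[ℝ] ↥(V ⊔ Submodule.span ℝ {w}) →ₗ[ℝ]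
      ↥(V ⊔ Submodule.span ℝ {w}) :=
  LinearMap.mk₂ ℝ (fun x y => ⟪(x : E), B y⟫ •
      ⟨w, Submodule.mem_sup_right (Submodule.mem_span_singleton_self w)⟩)
    (fun x y z => by rw [Submodule.coe_add, inner_add_left, add_smul])
    (fun r x y => by rw [Submodule.coe_smul, real_inner_smul_left, mul_smul])
    (fun x y z => by rw [Submodule.coe_add, map_add, inner_add_right, add_smul])
    (fun r x y => by rw [Submodule.coe_smul, map_smul, inner_smul_right, mul_smul])

theorem coe_contactBracket (V : Submodule ℝ E) (w : E) (B : E →L[ℝ] E)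
    (x y : ↥(V ⊔ Submodule.span ℝ {w})) : (contactBracket V w B x y : E) = ⟪(x : E), B y⟫ • w :=
  rfl

variable [FiniteDimensional ℝ E]

/-- The extension of an operator of the first layer to the ambient space, by zero on the
orthogonal complement. -/
noncomputable def extendOp (S : StepTwoAlgebra E) (A : S.V₁ →L[ℝ] S.V₁) : E →L[ℝ] E :=
  S.V₁.subtypeL ∘L A ∘L S.V₁.orthogonalProjectionOnto

theorem extendOp_apply (S : StepTwoAlgebra E) (A : S.V₁ →L[ℝ] S.V₁) (x : E) :
    S.extendOp A x = (A (S.V₁.orthogonalProjectionOnto x) : S.V₁) := rfl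

theorem extendOp_coe (S : StepTwoAlgebra E) (A : S.V₁ →L[ℝ] S.V₁) (x : S.V₁) :
    S.extendOp A x = (A x : S.V₁) := by
  rw [extendOp_apply, Submodule.orthogonalProjectionOnto_mem_subspace_eq_self]

theorem proj_eq_zero_of_mem_V₂ (S : StepTwoAlgebra E) {w : E} (hw : w ∈ S.V₂) :
    S.V₁.orthogonalProjectionOnto w = 0 :=
  Submodule.orthogonalProjectionOnto_eq_zero_iff.2
    ((Submodule.mem_orthogonal _ _).2 fun _ hx => S.inner_eq_zero hx hw)

theorem extendOp_eq_zero (S : StepTwoAlgebra E) (A : S.V₁ →L[ℝ] S.V₁) {w : E} (hw : w ∈ S.V₂) :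
    S.extendOp A w = 0 := by
  rw [extendOp_apply, S.proj_eq_zero_of_mem_V₂ hw, map_zero, Submodule.coe_zero]

theorem inner_proj (S : StepTwoAlgebra E) (x : E) (y : S.V₁) :
    ⟪S.V₁.orthogonalProjectionOnto x, y⟫ = ⟪x, (y : E)⟫ := by
  have h := S.V₁.starProjection_inner_eq_zero x y y.2
  rw [inner_sub_left, sub_eq_zero] at h
  exact h.symm

theorem extendOp_skew (S : StepTwoAlgebra E) {A : S.V₁ →L[ℝ] S.V₁}
    (hA : ∀ x y : S.V₁, ⟪A x, y⟫ = -⟪x, A y⟫) (x y : E) :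
    ⟪S.extendOp A x, y⟫ = -⟪x, S.extendOp A y⟫ := by
  rw [real_inner_comm, extendOp_apply, extendOp_apply, ← inner_proj, ← inner_proj, real_inner_comm,
    hA]

theorem mem_carrier_eq (S : StepTwoAlgebra E) (g : S.carrier) :
    ∃ z : S.carrier, (z : E) ∈ S.V₂ ∧
      g = S.inclFirst (S.V₁.orthogonalProjectionOnto g) + z := by
  have hg : (g : E) ∈ S.V₁ ⊔ S.V₂ := by rw [S.sup_eq]; exact g.2
  obtain ⟨a, ha, b, hb, hab⟩ := Submodule.mem_sup.1 hg
  refine ⟨⟨b, S.V₂_le hb⟩, hb, Subtype.ext ?_⟩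
  rw [← hab, map_add, S.proj_eq_zero_of_mem_V₂ hb, add_zero]
  have h := Submodule.orthogonalProjectionOnto_mem_subspace_eq_self (⟨a, ha⟩ : S.V₁)
  simp only at h
  rw [h]
  rfl

/-- The bracket of `S` in terms of a structure operator. -/
theorem bracket_eq {S : StepTwoAlgebra E} {w : E} {A : S.V₁ →L[ℝ] S.V₁}
    (hA : S.IsStructureOperator w A) (g k : S.carrier) :
    (S.bracket g k : E) = ⟪(g : E), S.extendOp A k⟫ • w := by
  obtain ⟨y, hy, hgy⟩ := S.mem_carrier_eq g
  obtain ⟨z, hz, hkz⟩ := S.mem_carrier_eq k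
  have h1 : S.bracket g k = S.bracket (S.inclFirst (S.V₁.orthogonalProjectionOnto g))
      (S.inclFirst (S.V₁.orthogonalProjectionOnto k)) := by
    conv_lhs => rw [hgy, hkz]
    rw [map_add, S.bracket_second _ _ hz, add_zero, bracket_neg_swap, map_add,
      S.bracket_second _ _ hy, add_zero, ← bracket_neg_swap]
  rw [h1, hA.2, inner_proj, extendOp_apply]

theorem existsUnique_isStructureOperator {S : StepTwoAlgebra E} (hS : S.IsContact) {w : E}
    (hw : w ∈ S.V₂) (hw0 : w ≠ 0) : ∃! A : S.V₁ →L[ℝ] S.V₁, S.IsStructureOperator w A := by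
  have hww : ⟪w, w⟫ ≠ 0 := inner_self_ne_zero.2 hw0
  -- the coefficient of a vector of `V₂` with respect to `w`
  have hcoef : ∀ x y : S.carrier,
      (S.bracket x y : E) = (⟪w, (S.bracket x y : E)⟫ / ⟪w, w⟫) • w := by
    intro x y
    have h := S.bracket_mem x y
    rw [V₂_eq_span hS hw hw0, Submodule.mem_span_singleton] at h
    obtain ⟨r, hr⟩ := h
    rw [← hr, inner_smul_right, mul_div_assoc, div_self hww, mul_one]
  set b := stdOrthonormalBasis ℝ S.V₁ with hb
  let β : S.V₁ → S.V₁ → ℝ := fun x y =>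
    ⟪w, (S.bracket (S.inclFirst x) (S.inclFirst y) : E)⟫ / ⟪w, w⟫
  let A₀ : S.V₁ →ₗ[ℝ] S.V₁ :=
    { toFun := fun y => ∑ i, β (b i) y • b i
      map_add' := fun y z => by
        simp only [β, inclFirst_add, map_add, Submodule.coe_add, inner_add_right, add_div, add_smul,
          Finset.sum_add_distrib]
      map_smul' := fun r y => by
        simp only [β, inclFirst_smul, map_smul, Submodule.coe_smul, inner_smul_right, mul_div_assoc,
          mul_smul, Finset.smul_sum, RingHom.id_apply] }
  have hA₀ : ∀ x y, ⟪x, A₀ y⟫ = β x y := by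
    intro x y
    have h1 : ⟪x, A₀ y⟫ = ∑ i, ⟪x, b i⟫ * β (b i) y := by
      change ⟪x, ∑ i, β (b i) y • b i⟫ = _
      rw [inner_sum]
      exact Finset.sum_congr rfl fun i _ => by rw [inner_smul_right, mul_comm]
    have h2 : S.inclFirst x = ∑ i, ⟪b i, x⟫ • S.inclFirst (b i) := by
      apply Subtype.ext
      have h3 := congrArg (fun z : S.V₁ => (z : E)) (b.sum_repr' x)
      simp only [Submodule.coe_sum, Submodule.coe_smul] at h3
      simp only [Submodule.coe_sum, Submodule.coe_smul, coe_inclFirst]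
      exact h3.symm
    rw [h1]
    simp only [β]
    rw [h2]
    simp only [map_sum, map_smul, LinearMap.sum_apply, LinearMap.smul_apply, Submodule.coe_sum,
      Submodule.coe_smul, inner_sum, inner_smul_right, Finset.sum_div, mul_div_assoc,
      real_inner_comm x]
  refine ⟨A₀.toContinuousLinearMap, ⟨fun x y => ?_, fun x y => ?_⟩, fun A' hA' => ?_⟩
  · rw [real_inner_comm]
    change ⟪y, A₀ x⟫ = -⟪x, A₀ y⟫
    rw [hA₀, hA₀]
    simp only [β]
    rw [bracket_neg_swap, Submodule.coe_neg, inner_neg_right, neg_div]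
  · change _ = ⟪x, A₀ y⟫ • w
    rw [hA₀]
    exact hcoef _ _
  · ext1 y
    refine ext_inner_left ℝ fun x => ?_
    change _ = ⟪x, A₀ y⟫
    rw [hA₀]
    simp only [β]
    rw [hA'.2, inner_smul_right, mul_div_assoc, div_self hww, mul_one]

/-- The algebra of contact type on `V ⊕ ℝ w` with the bracket `[x, y] = ⟪x, B y⟫ w`. -/
noncomputable def contactAlgebra (V : Submodule ℝ E) (w : E) (B : E →L[ℝ] E)
    (hskew : ∀ x y, ⟪B x, y⟫ = -⟪x, B y⟫) (hBV : ∀ x, B x ∈ V) (hwV : w ∈ Vᗮ) (hw0 : w ≠ 0)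
    (hB : B ≠ 0) : StepTwoAlgebra E :=
  have hwB : ∀ y, ⟪w, B y⟫ = 0 := fun y =>
    (real_inner_comm _ _).trans ((Submodule.mem_orthogonal _ _).1 hwV _ (hBV y))
  have hBw : B w = 0 := by
    refine ext_inner_right ℝ fun y => ?_
    rw [hskew, hwB, neg_zero, inner_zero_left]
  { carrier := V ⊔ Submodule.span ℝ {w}
    V₁ := V
    V₂ := Submodule.span ℝ {w}
    bracket := contactBracket V w B
    sup_eq := rfl
    orthogonal := by
      rw [Submodule.isOrtho_comm, Submodule.IsOrtho, Submodule.span_singleton_le_iff_mem]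
      exact hwV
    V₂_ne_bot := by simpa using hw0
    bracket_self := fun x => Subtype.ext <| by
      rw [coe_contactBracket, inner_self_eq_zero_of_skew hskew, zero_smul, Submodule.coe_zero]
    jacobi := fun x y z => Subtype.ext <| by
      simp [coe_contactBracket, hBw, inner_smul_left, hwB]
    bracket_first := by
      refine le_antisymm (Submodule.span_le.2 ?_) ?_
      · rintro _ ⟨x, y, -, -, rfl⟩
        exact Submodule.smul_mem _ _ (Submodule.mem_span_singleton_self w)
      · obtain ⟨y, hy⟩ : ∃ y, B y ≠ 0 := by
          by_contra! h
          exact hB (ContinuousLinearMap.ext h)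
        have hy' : B (B y) ≠ 0 := fun h => hy (apply_eq_zero_of_skew hskew h)
        rw [Submodule.span_singleton_le_iff_mem]
        have h : ⟪B (B y), B (B y)⟫ • w ∈ Submodule.span ℝ
            {z : E | ∃ x y : ↥(V ⊔ Submodule.span ℝ {w}), (x : E) ∈ V ∧ (y : E) ∈ V ∧
              z = (contactBracket V w B x y : E)} :=
          Submodule.subset_span ⟨⟨B (B y), Submodule.mem_sup_left (hBV _)⟩,
            ⟨B y, Submodule.mem_sup_left (hBV _)⟩, hBV _, hBV _, rfl⟩
        exact (Submodule.smul_mem_iff _ (inner_self_ne_zero.2 hy')).1 h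
    bracket_second := fun x y hy => Subtype.ext <| by
      obtain ⟨r, hr⟩ := Submodule.mem_span_singleton.1 hy
      rw [coe_contactBracket, ← hr, map_smul, hBw, smul_zero, inner_zero_right, zero_smul,
        Submodule.coe_zero] }

/-- The curves of the family determined by `(S, w)` are orbits of the flow of the extended
structure operator, which fixes `w`. -/
theorem coe_expFlow_add (S : StepTwoAlgebra E) {w : E} (hw : w ∈ S.V₂) (A : S.V₁ →L[ℝ] S.V₁)
    (v : S.V₁) (s : ℝ) :
    ((expFlow A s v : S.V₁) : E) + w = expFlow (S.extendOp A) s (v + w) := by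
  have : CompleteSpace E := FiniteDimensional.complete ℝ E
  have : CompleteSpace S.V₁ := FiniteDimensional.complete ℝ S.V₁
  rw [expFlow_add_right, expFlow_of_apply_eq_zero _ (S.extendOp_eq_zero A hw)]
  congr 1
  exact map_expFlow S.V₁.subtypeL (fun v => (S.extendOp_coe A v).symm) s v

/-- The extended structure operator shifts the derivatives of a curve of the family determined by
`(S, w)`; hence it is determined by the curve on the horizontal space. -/
theorem iteratedDerivWithin_succ_family (S : StepTwoAlgebra E) {w : E} (hw : w ∈ S.V₂)
    {A : S.V₁ →L[ℝ] S.V₁} {I : Set ℝ} (hI : IsInterval I) {γ : ℝ → E} {v : S.V₁}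
    (hγ : ∀ s ∈ I, γ s = ((expFlow A s v : S.V₁) : E) + w) (j : ℕ) {s : ℝ} (hs : s ∈ I) :
    iteratedDerivWithin (j + 1) γ I s = S.extendOp A (iteratedDerivWithin j γ I s) := by
  have : CompleteSpace E := FiniteDimensional.complete ℝ E
  have h : ∀ s ∈ I, γ s = expFlow (S.extendOp A) s (v + w) := fun s hs => by
    rw [hγ s hs, S.coe_expFlow_add hw]
  rw [iteratedDerivWithin_eq_expFlow hI h _ hs, iteratedDerivWithin_eq_expFlow hI h _ hs,
    apply_expFlow, pow_succ']
  rfl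

theorem orthogonal_starProjection_add (S : StepTwoAlgebra E) {w : E} (hw : w ∈ S.V₂) (x : S.V₁) :
    S.V₁ᗮ.starProjection ((x : E) + w) = w := by
  rw [map_add, Submodule.starProjection_orthogonal_apply_eq_zero x.2, zero_add]
  exact Submodule.starProjection_eq_self_iff.2
    ((Submodule.mem_orthogonal _ _).2 fun _ hx => S.inner_eq_zero hx hw)

theorem eq_of_isDeterminedBy {I : Set ℝ} (hI : IsInterval I) {γ : ℝ → E} {S S' : StepTwoAlgebra E}
    (hS : S.IsDeterminedBy I γ) (hS' : S'.IsDeterminedBy I γ) : S = S' := by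
  obtain ⟨s₀, hs₀⟩ : I.Nonempty := hI.2.mono interior_subset
  obtain ⟨hC, hV, w, hw, hw0, A, hA, v, hγ⟩ := hS
  obtain ⟨hC', hV', w', hw', hw0', A', hA', v', hγ'⟩ := hS'
  have hVV : S.V₁ = S'.V₁ := hV.trans hV'.symm
  have hww : w = w' := by
    have h := (hγ s₀ hs₀).symm.trans (hγ' s₀ hs₀)
    refine (S.orthogonal_starProjection_add hw (expFlow A s₀ v)).symm.trans
      (Eq.trans ?_ (S'.orthogonal_starProjection_add hw' (expFlow A' s₀ v')))
    rw [h]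
    simp only [hVV]
  subst hww
  have hBB : S.extendOp A = S'.extendOp A' := by
    have h1 : ∀ x ∈ S.V₁, S.extendOp A x = S'.extendOp A' x := by
      intro x hx
      rw [hV] at hx
      induction hx using Submodule.span_induction with
      | zero => simp
      | add x y _ _ hx hy => rw [map_add, map_add, hx, hy]
      | smul r x _ hx => rw [map_smul, map_smul, hx]
      | mem x hx =>
        obtain ⟨j, -, s, hs, rfl⟩ := hx
        rw [← S.iteratedDerivWithin_succ_family hw hI hγ j hs,
          ← S'.iteratedDerivWithin_succ_family hw' hI hγ' j hs]
    ext x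
    rw [← S.V₁.starProjection_add_starProjection_orthogonal x, map_add, map_add,
      h1 _ (S.V₁.starProjection_apply_mem x)]
    congr 1
    have h2 := S.V₁ᗮ.starProjection_apply_mem x
    rw [extendOp_apply, extendOp_apply, Submodule.orthogonalProjectionOnto_eq_zero_iff.2 h2,
      Submodule.orthogonalProjectionOnto_eq_zero_iff.2 (hVV ▸ h2), map_zero, map_zero]
    simp
  refine eq_of_bracket_eq hVV ?_ (β := fun x y => ⟪x, S.extendOp A y⟫ • w)
    (fun x y => bracket_eq hA x y) fun x y => ?_
  · rw [V₂_eq_span hC hw hw0, V₂_eq_span hC' hw' hw0]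
  · rw [bracket_eq hA', hBB]

theorem existsUnique_isDeterminedBy {I : Set ℝ} (hI : IsInterval I) {γ : ℝ → E} (hγ : IsQ 0 I γ)
    (hne : ¬ IsConstantOn I γ) (hhyp : LiesInHyperplaneOffOrigin I γ) :
    ∃! S : StepTwoAlgebra E, S.IsDeterminedBy I γ := by
  have : CompleteSpace E := FiniteDimensional.complete ℝ E
  obtain ⟨s₀, hs₀⟩ : I.Nonempty := hI.2.mono interior_subset
  obtain ⟨B, hskew, hshift, hBV⟩ := hγ.exists_skew_operator hI
  set V := horizontalSpace I γ with hV
  have hder : ∀ s ∈ I, HasDerivWithinAt γ (B (γ s)) I s := by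
    intro s hs
    have h := hshift 0 s hs
    rw [zero_add, iteratedDerivWithin_one, iteratedDerivWithin_zero] at h
    rw [← h]
    exact ((hγ.1.differentiableOn (by simp)) s hs).hasDerivWithinAt
  set w := γ s₀ - V.starProjection (γ s₀) with hw
  have hwV : w ∈ Vᗮ := V.sub_starProjection_mem_orthogonal _
  have hBw : B w = 0 := by
    refine ext_inner_right ℝ fun y => ?_
    rw [hskew, inner_zero_left, neg_eq_zero, real_inner_comm]
    exact (Submodule.mem_orthogonal _ _).1 hwV _ (hBV y)
  have hw0 : w ≠ 0 := by
    obtain ⟨u, k, hk, huk⟩ := hhyp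
    -- the normal vector of the hyperplane is orthogonal to the horizontal space
    have hu : ∀ x ∈ V, ⟪u, x⟫ = 0 := by
      have h0 : ∀ s ∈ I, ⟪u, B (γ s)⟫ = 0 := by
        intro s hs
        have h1 := (hasDerivWithinAt_const s I u).inner ℝ (hder s hs)
        have h2 : HasDerivWithinAt (fun t => ⟪u, γ t⟫) 0 I s :=
          (hasDerivWithinAt_const s I k).congr huk (huk s hs)
        have h3 := (hI.uniqueDiffOn s hs).eq_deriv _ h1 h2
        simpa using h3
      have hjet : ∀ j, ∀ s ∈ I, ⟪u, iteratedDerivWithin (j + 1) γ I s⟫ = 0 := by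
        intro j
        induction j with
        | zero =>
          intro s hs
          rw [hshift 0 s hs, iteratedDerivWithin_zero]
          exact h0 s hs
        | succ j ih =>
          intro s hs
          have hd : HasDerivWithinAt (iteratedDerivWithin (j + 1) γ I)
              (iteratedDerivWithin (j + 1 + 1) γ I s) I s := by
            rw [iteratedDerivWithin_succ (n := j + 1)]
            exact (hγ.1.differentiableOn_iteratedDerivWithin (m := j + 1)
              (by exact_mod_cast WithTop.coe_lt_top (j + 1)) hI.uniqueDiffOn s hs).hasDerivWithinAt
          have h1 := (hasDerivWithinAt_const s I u).inner ℝ hd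
          have h2 : HasDerivWithinAt (fun t => ⟪u, iteratedDerivWithin (j + 1) γ I t⟫) 0 I s :=
            (hasDerivWithinAt_const s I (0 : ℝ)).congr ih (ih s hs)
          have h3 := (hI.uniqueDiffOn s hs).eq_deriv _ h1 h2
          simpa using h3
      intro x hx
      induction hx using Submodule.span_induction with
      | zero => simp
      | add x y _ _ hx hy => rw [inner_add_right, hx, hy, add_zero]
      | smul r x _ hx => rw [inner_smul_right, hx, mul_zero]
      | mem x hx =>
        obtain ⟨j, hj, s, hs, rfl⟩ := hx
        obtain ⟨i, rfl⟩ := Nat.exists_eq_add_of_le' hj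
        exact hjet i s hs
    intro h
    apply hk
    rw [← huk s₀ hs₀, sub_eq_zero.1 (hw.symm.trans h), hu _ (V.starProjection_apply_mem _)]
  have hB0 : B ≠ 0 := by
    rintro rfl
    exact hne ⟨γ s₀, fun s hs => eq_of_hasDerivWithinAt_zero hI.1 (by simpa using hder) hs hs₀⟩
  let S := contactAlgebra V w B hskew hBV hwV hw0 hB0
  have hSV₁ : S.V₁ = V := rfl
  let A : S.V₁ →L[ℝ] S.V₁ := (B ∘L V.subtypeL).codRestrict V fun x => hBV x
  have : CompleteSpace S.V₁ := FiniteDimensional.complete ℝ S.V₁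
  let v₀ : S.V₁ := V.orthogonalProjectionOnto (γ s₀)
  suffices hS : S.IsDeterminedBy I γ from ⟨S, hS, fun S' hS' => eq_of_isDeterminedBy hI hS' hS⟩
  refine ⟨finrank_span_singleton hw0, rfl, w, Submodule.mem_span_singleton_self w, hw0, A,
    ⟨fun x y => hskew x y, fun x y => rfl⟩, expFlow A (-s₀) v₀, fun s hs => ?_⟩
  rw [← expFlow_add]
  have h1 : ((expFlow A (s + -s₀) v₀ : S.V₁) : E) = expFlow B (s + -s₀) (v₀ : E) :=
    map_expFlow S.V₁.subtypeL (B := B) (fun v => rfl) _ v₀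
  have h2 : γ s₀ = (v₀ : E) + w := by
    change _ = V.starProjection (γ s₀) + w
    rw [hw]; abel
  rw [eq_expFlow_of_hasDerivWithinAt B hI.1 hder hs₀ hs, h1, h2, expFlow_add_right,
    expFlow_of_apply_eq_zero B hBw, sub_eq_add_neg]

/-- The curves of the family determined by `S` and `w` are of class `Q_0`. -/
theorem isQ_family {S : StepTwoAlgebra E} {w : E} (hw : w ∈ S.V₂) {A : S.V₁ →L[ℝ] S.V₁}
    (hA : ∀ x y : S.V₁, ⟪A x, y⟫ = -⟪x, A y⟫) (v : S.V₁) :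
    IsQ 0 univ (fun s => ((expFlow A s v : S.V₁) : E) + w) := by
  have : CompleteSpace E := FiniteDimensional.complete ℝ E
  simp only [S.coe_expFlow_add hw]
  exact isQ_expFlow (S.extendOp_skew hA) _

theorem starProjection_add (S : StepTwoAlgebra E) {w : E} (hw : w ∈ S.V₂) (x : S.V₁) :
    S.V₁.starProjection ((x : E) + w) = x := by
  rw [map_add, Submodule.starProjection_eq_self_iff.2 x.2]
  change _ + ((S.V₁.orthogonalProjectionOnto w : S.V₁) : E) = _
  rw [S.proj_eq_zero_of_mem_V₂ hw]
  simp

theorem existsUnique_inFamily {S : StepTwoAlgebra E} (hS : S.IsContact) {w : E}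
    (hw : w ∈ S.V₂) (hw0 : w ≠ 0) {v : E} (hv : v ∈ S.V₁) :
    ∃! γ : ℝ → E, IsQ 0 univ γ ∧ S.InFamily w univ γ ∧ S.V₁.starProjection (γ 0) = v := by
  obtain ⟨A, hA, huniq⟩ := existsUnique_isStructureOperator hS hw hw0
  refine ⟨fun s => ((expFlow A s ⟨v, hv⟩ : S.V₁) : E) + w,
    ⟨isQ_family hw hA.1 _, ⟨A, hA, ⟨v, hv⟩, fun s _ => rfl⟩, ?_⟩, ?_⟩
  · simp only [expFlow_zero]
    exact S.starProjection_add hw ⟨v, hv⟩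
  · rintro γ ⟨-, ⟨A', hA', v', hγ⟩, h0⟩
    obtain rfl := huniq A' hA'
    rw [hγ 0 (mem_univ 0), expFlow_zero, S.starProjection_add hw] at h0
    funext s
    rw [hγ s (mem_univ s), show v' = ⟨v, hv⟩ from Subtype.ext h0]

end StepTwoAlgebra

/-! ### Hamilton's equations -/

namespace StepTwoAlgebra

variable {E : Type*} [NormedAddCommGroup E] [InnerProductSpace ℝ E]

theorem bracket_eq_zero_left (S : StepTwoAlgebra E) {x y : S.carrier} (hx : (x : E) ∈ S.V₂) :
    S.bracket x y = 0 := by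
  rw [bracket_neg_swap, S.bracket_second _ _ hx, neg_zero]

theorem bracket_leftField_left (S : StepTwoAlgebra E) (X g k : S.carrier) :
    S.bracket (S.leftField X g) k = S.bracket X k := by
  rw [leftField, map_add, LinearMap.add_apply, map_smul, LinearMap.smul_apply,
    S.bracket_eq_zero_left (S.bracket_mem g X), smul_zero, add_zero]

/-- The left-invariant field of a horizontal vector, as a linear map of that vector. -/
noncomputable def horizontalLift (S : StepTwoAlgebra E) (g : S.carrier) : S.V₁ →ₗ[ℝ] S.carrier where
  toFun X := S.leftField (S.inclFirst X) g
  map_add' X Y := by simp only [leftField, inclFirst_add, map_add, smul_add]; abel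
  map_smul' r X := by
    simp only [leftField, inclFirst_smul, map_smul, smul_add, RingHom.id_apply,
      smul_comm r (1 / 2 : ℝ)]

theorem horizontalLift_apply (S : StepTwoAlgebra E) (g : S.carrier) (X : S.V₁) :
    S.horizontalLift g X = S.leftField (S.inclFirst X) g := rfl

theorem bracket_inclFirst {S : StepTwoAlgebra E} {w : E} {A : S.V₁ →L[ℝ] S.V₁}
    (hA : S.IsStructureOperator w A) (hw : w ∈ S.V₂) (X Y : S.V₁) :
    S.bracket (S.inclFirst X) (S.inclFirst Y) = ⟪X, A Y⟫ • ⟨w, S.V₂_le hw⟩ :=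
  Subtype.ext (hA.2 X Y)

variable [FiniteDimensional ℝ E]

/-- The bracket with a fixed vector as a continuous linear map. -/
noncomputable def bracketRight (S : StepTwoAlgebra E) (X : S.carrier) : S.carrier →L[ℝ] S.carrier :=
  (S.bracket.flip X).toContinuousLinearMap

theorem bracketRight_apply (S : StepTwoAlgebra E) (X g : S.carrier) :
    S.bracketRight X g = S.bracket g X := rfl

/-- The left-invariant vector field of `X` along a differentiable curve. -/
theorem hasDerivAt_leftField (S : StepTwoAlgebra E) (X : S.carrier) {c : ℝ → S.carrier}
    {c' : S.carrier} {s : ℝ} (hc : HasDerivAt c c' s) :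
    HasDerivAt (fun s => S.leftField X (c s)) ((1 / 2 : ℝ) • S.bracket c' X) s :=
  (((S.bracketRight X).hasFDerivAt.comp_hasDerivAt s hc).const_smul (1 / 2 : ℝ)).const_add X

/-- The horizontal vector dual to the restriction of the covector `p` to the horizontal
space at `g`, which is identified with `V₁` by left translation. -/
noncomputable def momentum (S : StepTwoAlgebra E) (g : S.carrier) (p : S.carrier →L[ℝ] ℝ) : S.V₁ :=
  ∑ i, p (S.leftField (S.inclFirst (stdOrthonormalBasis ℝ S.V₁ i)) g) •
    stdOrthonormalBasis ℝ S.V₁ i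

theorem inner_momentum (S : StepTwoAlgebra E) (g : S.carrier) (p : S.carrier →L[ℝ] ℝ) (X : S.V₁) :
    ⟪S.momentum g p, X⟫ = p (S.leftField (S.inclFirst X) g) := by
  conv_rhs => rw [← horizontalLift_apply, ← (stdOrthonormalBasis ℝ S.V₁).sum_repr' X]
  simp only [momentum, sum_inner, real_inner_smul_left, map_sum, map_smul, smul_eq_mul,
    horizontalLift_apply]
  exact Finset.sum_congr rfl fun i _ => mul_comm _ _

theorem hasFDerivAt_hamiltonian_covector (S : StepTwoAlgebra E) (g : S.carrier)
    (p : S.carrier →L[ℝ] ℝ) :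
    HasFDerivAt (fun p' => S.hamiltonian g p')
      (ContinuousLinearMap.apply ℝ ℝ (S.leftField (S.inclFirst (S.momentum g p)) g)) p := by
  have h := (HasFDerivAt.fun_sum (u := Finset.univ) fun i _ =>
    ((ContinuousLinearMap.apply ℝ ℝ
      (S.leftField (S.inclFirst (stdOrthonormalBasis ℝ S.V₁ i)) g)).hasFDerivAt
        (x := p)).pow 2).const_mul (1 / 2 : ℝ)
  refine h.congr_fderiv ?_
  ext q
  rw [← horizontalLift_apply, momentum]
  simp only [map_sum, map_smul, horizontalLift_apply, one_div, Nat.add_one_sub_one, pow_one,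
    nsmul_eq_mul, Nat.cast_ofNat, smul_apply, sum_apply, ContinuousLinearMap.apply_apply,
    smul_eq_mul, Finset.mul_sum]
  exact Finset.sum_congr rfl fun i _ => by ring

theorem hasFDerivAt_hamiltonian_base (S : StepTwoAlgebra E) (g : S.carrier)
    (p : S.carrier →L[ℝ] ℝ) :
    HasFDerivAt (fun g' => S.hamiltonian g' p)
      ((1 / 2 : ℝ) • p ∘L S.bracketRight (S.inclFirst (S.momentum g p))) g := by
  have h := (HasFDerivAt.fun_sum (u := Finset.univ) fun i _ =>
    (p.hasFDerivAt.comp g (((S.bracketRight (S.inclFirst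
      (stdOrthonormalBasis ℝ S.V₁ i))).hasFDerivAt (x := g)).const_smul
        (1 / 2 : ℝ) |>.const_add (S.inclFirst (stdOrthonormalBasis ℝ S.V₁ i)))).pow 2).const_mul
          (1 / 2 : ℝ)
  refine h.congr_fderiv ?_
  ext u
  have h2 : S.inclFirst (S.momentum g p) =
      ∑ i, p (S.leftField (S.inclFirst (stdOrthonormalBasis ℝ S.V₁ i)) g) •
        S.inclFirst (stdOrthonormalBasis ℝ S.V₁ i) := by
    apply Subtype.ext
    simp [momentum]
  simp only [smul_apply, ContinuousLinearMap.comp_apply, bracketRight_apply, h2,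
    map_sum, map_smul, smul_eq_mul, Finset.mul_sum, sum_apply]
  refine Finset.sum_congr rfl fun i _ => ?_
  simp only [leftField, Function.comp_apply, map_add, map_smul, smul_eq_mul, Pi.smul_apply,
    nsmul_eq_mul, bracketRight_apply]
  simp
  ring

theorem hamiltonEquationsAt_iff (S : StepTwoAlgebra E) (c : ℝ → S.carrier)
    (p : ℝ → (S.carrier →L[ℝ] ℝ)) (s : ℝ) :
    S.HamiltonEquationsAt c p s ↔ ∃ p' : S.carrier →L[ℝ] ℝ,
      HasDerivAt c (S.leftField (S.inclFirst (S.momentum (c s) (p s))) (c s)) s ∧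
      HasDerivAt p p' s ∧
      ∀ u, p' u = -(1 / 2 * p s (S.bracket u (S.inclFirst (S.momentum (c s) (p s))))) := by
  rw [HamiltonEquationsAt, (S.hasFDerivAt_hamiltonian_covector (c s) (p s)).fderiv,
    (S.hasFDerivAt_hamiltonian_base (c s) (p s)).fderiv]
  simp only [ContinuousLinearMap.apply_apply, smul_apply, smul_eq_mul,
    ContinuousLinearMap.comp_apply, bracketRight_apply]
  constructor
  · rintro ⟨hc, hp, h1, h2⟩
    have h3 : deriv c s = S.leftField (S.inclFirst (S.momentum (c s) (p s))) (c s) :=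
      by_contra fun hne => by
        obtain ⟨f, hf⟩ := SeparatingDual.exists_separating_of_ne (R := ℝ) hne
        exact hf (h1 f)
    -- the explicit arguments fix the norm of the dual space, which unification does not find
    have h4 : HasDerivAt p (deriv p s) s := by
      have h5 := DifferentiableAt.hasDerivAt (𝕜 := ℝ) (F := S.carrier →L[ℝ] ℝ) (f := p) (x := s) hp
      exact h5
    refine ⟨deriv p s, ?_, h4, h2⟩
    rw [← h3]
    exact hc.hasDerivAt
  · rintro ⟨p', hc, hp, h⟩
    have h4 : deriv p s = p' := by
      have h5 := HasDerivAt.deriv (𝕜 := ℝ) (F := S.carrier →L[ℝ] ℝ) (f := p) (x := s) hp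
      exact h5
    have h5 : deriv c s = _ := HasDerivAt.deriv hc
    have h6 : DifferentiableAt ℝ p s := by
      have h7 := HasDerivAt.differentiableAt (𝕜 := ℝ) (F := S.carrier →L[ℝ] ℝ) (f := p) (x := s) hp
      exact h7
    refine ⟨hc.differentiableAt, h6, fun q => by rw [h5], fun u => ?_⟩
    rw [h4, h]

variable {S : StepTwoAlgebra E} {w : E} {A : S.V₁ →L[ℝ] S.V₁}

/-- Along a bicharacteristic the horizontal velocity satisfies a linear equation, the coefficient
being the conserved vertical momentum. -/
theorem IsStructureOperator.exists_velocity (hA : S.IsStructureOperator w A) (hw : w ∈ S.V₂)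
    {c : ℝ → S.carrier} {p : ℝ → (S.carrier →L[ℝ] ℝ)} {J : Set ℝ} (hJ : J.OrdConnected)
    (h : ∀ s ∈ J, S.HamiltonEquationsAt c p s) :
    ∃ (l : ℝ) (h : ℝ → S.V₁), ∀ s ∈ J,
      HasDerivAt c (S.leftField (S.inclFirst (h s)) (c s)) s ∧ HasDerivAt h ((l • A) (h s)) s := by
  rcases J.eq_empty_or_nonempty with rfl | ⟨s₀, hs₀⟩
  · exact ⟨0, 0, by simp⟩
  set W : S.carrier := ⟨w, S.V₂_le hw⟩ with hW
  have hp : ∀ s ∈ J, p s W = p s₀ W := by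
    refine fun s hs => eq_of_hasDerivWithinAt_zero (f := fun s => p s W) hJ (fun r hr => ?_) hs hs₀
    obtain ⟨p', -, hp, hp'⟩ := (S.hamiltonEquationsAt_iff c p r).1 (h r hr)
    have h1 := (hp.clm_apply (hasDerivAt_const r W)).hasDerivWithinAt (s := J)
    refine h1.congr_deriv ?_
    rw [hp', S.bracket_eq_zero_left hw]
    simp
  refine ⟨-(p s₀ W), fun s => S.momentum (c s) (p s), fun s hs => ?_⟩
  obtain ⟨p', hc, hp1, hp2⟩ := (S.hamiltonEquationsAt_iff c p s).1 (h s hs)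
  refine ⟨hc, ?_⟩
  set m := S.momentum (c s) (p s) with hm
  set b := stdOrthonormalBasis ℝ S.V₁ with hb
  have h1 := HasDerivAt.fun_sum (u := Finset.univ) fun i _ =>
    (hp1.clm_apply (S.hasDerivAt_leftField (S.inclFirst (b i)) hc)).smul_const (b i)
  refine h1.congr_deriv ?_
  rw [smul_apply, ← b.sum_repr' (A m), Finset.smul_sum]
  refine Finset.sum_congr rfl fun i _ => ?_
  rw [smul_smul]
  congr 1
  rw [hp2, bracket_leftField_left, bracket_leftField_left, bracket_inclFirst hA hw,
    bracket_inclFirst hA hw, ← hW, map_smul, map_smul, map_smul, hp s hs]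
  have h2 := hA.1 m (b i)
  rw [real_inner_comm] at h2
  simp only [smul_eq_mul]
  linear_combination (1 / 2 * p s₀ W) * h2

theorem proj_inclFirst_add (S : StepTwoAlgebra E) (X : S.V₁) {z : S.carrier} (hz : (z : E) ∈ S.V₂) :
    S.V₁.orthogonalProjectionOnto ((S.inclFirst X + z : S.carrier) : E) = X := by
  rw [Submodule.coe_add, map_add, S.proj_eq_zero_of_mem_V₂ hz, add_zero]
  exact Submodule.orthogonalProjectionOnto_mem_subspace_eq_self X

theorem proj_leftField (S : StepTwoAlgebra E) (X : S.V₁) (g : S.carrier) :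
    S.V₁.orthogonalProjectionOnto (S.leftField (S.inclFirst X) g : E) = X :=
  S.proj_inclFirst_add X (Submodule.smul_mem _ _ (S.bracket_mem _ _))

/-- The orthogonal projection to the first layer, on the algebra. -/
noncomputable def projFirst (S : StepTwoAlgebra E) : S.carrier →L[ℝ] S.V₁ :=
  S.V₁.orthogonalProjectionOnto ∘L S.carrier.subtypeL

theorem projFirst_apply (S : StepTwoAlgebra E) (g : S.carrier) :
    S.projFirst g = S.V₁.orthogonalProjectionOnto (g : E) := rfl

theorem projFirst_leftField (S : StepTwoAlgebra E) (X : S.V₁) (g : S.carrier) :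
    S.projFirst (S.leftField (S.inclFirst X) g) = X := S.proj_leftField X g

theorem coe_projFirst (S : StepTwoAlgebra E) (g : S.carrier) :
    ((S.projFirst g : S.V₁) : E) = S.V₁.starProjection (g : E) := rfl

theorem leftField_eq_of_structureOperator (hA : S.IsStructureOperator w A) (hw : w ∈ S.V₂)
    (X : S.V₁) (g : S.carrier) : S.leftField (S.inclFirst X) g =
      S.inclFirst X + ((1 / 2 : ℝ) * ⟪S.projFirst g, A X⟫) • ⟨w, S.V₂_le hw⟩ := by
  apply Subtype.ext
  rw [leftField, Submodule.coe_add, Submodule.coe_smul, bracket_eq hA, coe_inclFirst, extendOp_coe,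
    ← inner_proj, projFirst_apply, smul_smul]
  rfl

/-- A horizontal curve whose velocity rotates by the flow of the structure operator is the
projection of a bicharacteristic, with vertical momentum `-1`. -/
theorem IsStructureOperator.exists_bicharacteristic (hA : S.IsStructureOperator w A)
    (hw : w ∈ S.V₂) (hw0 : w ≠ 0) {c : ℝ → S.carrier} {h : ℝ → S.V₁}
    (hc : ∀ s, HasDerivAt c (S.leftField (S.inclFirst (h s)) (c s)) s)
    (hh : ∀ s, HasDerivAt h (A (h s)) s) :
    ∃ p : ℝ → (S.carrier →L[ℝ] ℝ), ∀ s, S.HamiltonEquationsAt c p s := by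
  have hww : ⟪w, w⟫ ≠ 0 := inner_self_ne_zero.2 hw0
  -- the covector at time `s`, represented by a vector of the ambient space
  let q : ℝ → E := fun s => (h s : E) - (1 / 2 : ℝ) • ((A (S.projFirst (c s)) : S.V₁) : E) -
    (⟪w, w⟫⁻¹ : ℝ) • w
  let Λ : E →L[ℝ] (S.carrier →L[ℝ] ℝ) :=
    (ContinuousLinearMap.compL ℝ S.carrier E ℝ).flip S.carrier.subtypeL ∘L innerSL ℝ
  have hΛ : ∀ x u, Λ x u = ⟪x, (u : E)⟫ := fun x u => rfl
  have hx : ∀ s, HasDerivAt (fun s => S.projFirst (c s)) (h s) s := by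
    intro s
    have := S.projFirst.hasFDerivAt.comp_hasDerivAt s (hc s)
    rwa [projFirst_leftField] at this
  have hq : ∀ s, HasDerivAt q ((1 / 2 : ℝ) • ((A (h s) : S.V₁) : E)) s := by
    intro s
    have h1 := S.V₁.subtypeL.hasFDerivAt.comp_hasDerivAt s (hh s)
    have h2 := (S.V₁.subtypeL ∘L A).hasFDerivAt.comp_hasDerivAt s (hx s)
    refine ((h1.sub (h2.const_smul (1 / 2 : ℝ))).sub_const ((⟪w, w⟫⁻¹ : ℝ) • w)).congr_deriv ?_
    simp only [ContinuousLinearMap.comp_apply, Submodule.subtypeL_apply]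
    module
  have hqw : ∀ s, ⟪q s, w⟫ = -1 := by
    intro s
    simp only [q, inner_sub_left, real_inner_smul_left, S.inner_eq_zero (Subtype.coe_prop _) hw,
      inv_mul_cancel₀ hww]
    norm_num
  have hmom : ∀ s, S.momentum (c s) (Λ (q s)) = h s := by
    intro s
    refine ext_inner_right ℝ fun X => ?_
    rw [inner_momentum, leftField_eq_of_structureOperator hA hw, hΛ, Submodule.coe_add,
      Submodule.coe_smul, inner_add_right, inner_smul_right, hqw, coe_inclFirst]
    have h3 : ⟪w, (X : E)⟫ = 0 := (real_inner_comm _ _).trans (S.inner_eq_zero X.2 hw)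
    have h4 := hA.1 (S.projFirst (c s)) X
    simp only [q, inner_sub_left, real_inner_smul_left, h3, ← Submodule.coe_inner] at h4 ⊢
    linear_combination (-1 / 2 : ℝ) * h4
  have hΛq : ∀ s, HasDerivAt (fun s => Λ (q s)) (Λ ((1 / 2 : ℝ) • ((A (h s) : S.V₁) : E))) s :=
    fun s =>
      HasFDerivAt.comp_hasDerivAt (F := E) (E := S.carrier →L[ℝ] ℝ) s
        (ContinuousLinearMap.hasFDerivAt (F := S.carrier →L[ℝ] ℝ) Λ) (hq s)
  refine ⟨fun s => Λ (q s), fun s => (S.hamiltonEquationsAt_iff _ _ s).2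
    ⟨Λ ((1 / 2 : ℝ) • ((A (h s) : S.V₁) : E)), ?_, hΛq s, fun u => ?_⟩⟩
  · rw [hmom]
    exact hc s
  · rw [hmom, hΛ, hΛ, bracket_eq hA, coe_inclFirst, extendOp_coe, inner_smul_right, hqw,
      real_inner_smul_left, real_inner_comm]
    ring

end StepTwoAlgebra

/-! ### Minimality of short trajectories -/

section minimality

variable {F : Type*} [NormedAddCommGroup F] [InnerProductSpace ℝ F] [CompleteSpace F]

/-- A curve `ξ` with the same end points as the trajectory `x` of `x'' = A x'` on `[a, b]`, and
with the same swept area `∫ ⟪ξ, A ξ'⟫`, is at least as long as `x`, provided `[a, b]` is short. -/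
theorem length_trajectory_le {A : F →L[ℝ] F} (hA : ∀ x y, ⟪A x, y⟫ = -⟪x, A y⟫) {a b : ℝ}
    (hab : a < b) (hsmall : ‖A‖ * (b - a) ≤ 1) {x h : ℝ → F} {Z : ℝ → ℝ} {ρ : ℝ}
    (hx : ∀ s, HasDerivAt x (h s) s) (hh : ∀ s, HasDerivAt h (A (h s)) s)
    (hZ : ∀ s, HasDerivAt Z ⟪x s, A (h s)⟫ s) (hρ : ∀ s, ‖h s‖ = ρ)
    {a' b' : ℝ} (hab' : a' < b') {ξ u : ℝ → F} {ζ : ℝ → ℝ} (hu : Continuous u)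
    (hξ : ∀ t, HasDerivAt ξ (u t) t) (hζ : ∀ t ∈ Icc a' b', HasDerivAt ζ ⟪ξ t, A (u t)⟫ t)
    (hξa : ξ a' = x a) (hξb : ξ b' = x b) (hζa : ζ a' = Z a) (hζb : ζ b' = Z b) :
    ρ * (b - a) ≤ ∫ t in a'..b', ‖u t‖ := by
  set L := ∫ t in a'..b', ‖u t‖ with hL
  have hL0 : 0 ≤ L := intervalIntegral.integral_nonneg hab'.le fun _ _ => norm_nonneg _
  have hℓ : 0 < b' - a' := sub_pos.2 hab'
  have hba : 0 < b - a := sub_pos.2 hab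
  have hρ0 : 0 ≤ ρ := (hρ 0) ▸ norm_nonneg _
  have hxc : Continuous x := continuous_iff_continuousAt.2 fun s => (hx s).continuousAt
  have hhc : Continuous h := continuous_iff_continuousAt.2 fun s => (hh s).continuousAt
  have hξc : Continuous ξ := continuous_iff_continuousAt.2 fun s => (hξ s).continuousAt
  -- `δ` keeps the time change below regular where the competitor is at rest
  have main : ∀ δ > 0, (ρ * (b - a)) ^ 2 ≤ L * (L + δ * (b' - a')) := by
    intro δ hδ
    set M := L + δ * (b' - a') with hM
    have hM0 : 0 < M := by positivity
    set k := (b - a) / M with hk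
    have hk0 : 0 < k := div_pos hba hM0
    -- a time change with positive speed `σ`, almost proportional to the speed of `ξ`
    set σ : ℝ → ℝ := fun t => k * (‖u t‖ + δ) with hσ
    have hσ0 : ∀ t, 0 < σ t := fun t => by positivity
    have hσc : Continuous σ := by fun_prop
    set τ : ℝ → ℝ := fun t => a + ∫ r in a'..t, σ r with hτ
    have hτd : ∀ t, HasDerivAt τ (σ t) t := fun t =>
      (hσc.integral_hasStrictDerivAt a' t).hasDerivAt.const_add a
    have hτc : Continuous τ := continuous_iff_continuousAt.2 fun s => (hτd s).continuousAt
    have hσint : ∫ r in a'..b', σ r = b - a := by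
      rw [hσ, intervalIntegral.integral_const_mul, intervalIntegral.integral_add
        (hu.norm.intervalIntegrable _ _) (continuous_const.intervalIntegrable _ _),
        intervalIntegral.integral_const, smul_eq_mul, ← hL, mul_comm (b' - a'), ← hM, hk]
      field_simp
    have hτa : τ a' = a := by simp [hτ]
    have hτb : τ b' = b := by simp only [hτ, hσint]; ring
    set e : ℝ → F := fun t => u t - σ t • h (τ t) with he
    have hec : Continuous e := by fun_prop
    set η : ℝ → F := fun t => ξ t - x (τ t) with hη
    have hηd : ∀ t, HasDerivAt η (e t) t := fun t => (hξ t).sub ((hx (τ t)).scomp t (hτd t))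
    have hηc : Continuous η := by fun_prop
    have hηa : η a' = 0 := by simp [hη, hτa, hξa]
    have hηb : η b' = 0 := by simp [hη, hτb, hξb]
    set N := ∫ t in a'..b', ‖e t‖ with hN
    clear_value L M k σ τ e η N
    have hN0 : 0 ≤ N := hN ▸ intervalIntegral.integral_nonneg hab'.le fun _ _ => norm_nonneg _
    have hηN : ∀ t ∈ Icc a' b', ‖η t‖ ≤ N := by
      intro t ht
      have h1 : ∫ r in a'..t, e r = η t := by
        rw [intervalIntegral.integral_eq_sub_of_hasDerivAt (fun r _ => hηd r)
          (hec.intervalIntegrable _ _), hηa, sub_zero]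
      rw [← h1, hN]
      refine (intervalIntegral.norm_integral_le_integral_norm ht.1).trans ?_
      exact intervalIntegral.integral_mono_interval le_rfl ht.1 ht.2
        (Eventually.of_forall fun _ => norm_nonneg _) (hec.norm.intervalIntegrable _ _)
    -- the first variation is an exact derivative up to the second order term `⟪η, A η'⟫`
    set Ψ : ℝ → ℝ := fun t => 2 * ⟪h (τ t), η t⟫ - (ζ t - Z (τ t) - ⟪x (τ t), A (η t)⟫) with hΨ
    have hΨd : ∀ t ∈ uIcc a' b', HasDerivAt Ψ (2 * ⟪h (τ t), e t⟫ - ⟪η t, A (e t)⟫) t := by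
      intro t ht
      rw [uIcc_of_le hab'.le] at ht
      have d1 := (((hh (τ t)).scomp t (hτd t)).inner ℝ (hηd t)).const_mul 2
      have d2 : HasDerivAt (fun t => Z (τ t)) _ t := (hZ (τ t)).comp t (hτd t)
      have d3 := ((hx (τ t)).scomp t (hτd t)).inner ℝ (A.hasFDerivAt.comp_hasDerivAt t (hηd t))
      refine (d1.sub (((hζ t ht).sub d2).sub d3)).congr_deriv ?_
      have e1 : u t = e t + σ t • h (τ t) := by simp [he]
      have e2 : ξ t = η t + x (τ t) := by simp [hη]
      have e3 := hA (h (τ t)) (η t)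
      have e4 : ⟪A (h (τ t)), η t⟫ = ⟪η t, A (h (τ t))⟫ := real_inner_comm _ _
      simp only [Function.comp_apply, real_inner_smul_left]
      rw [e1, e2]
      simp only [map_add, map_smul, inner_add_left, inner_add_right, inner_smul_right]
      linear_combination σ t * e3 + σ t * e4
    have hΨint : ∫ t in a'..b', (2 * ⟪h (τ t), e t⟫ - ⟪η t, A (e t)⟫) = 0 := by
      rw [intervalIntegral.integral_eq_sub_of_hasDerivAt hΨd
        (Continuous.intervalIntegrable (by fun_prop) _ _)]
      simp [hΨ, hηa, hηb, hτa, hτb, hζa, hζb]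
    set m := N / (b - a) with hm
    have hm0 : 0 ≤ m := div_nonneg hN0 hba.le
    clear_value m Ψ
    -- `‖u‖² / σ` is bounded below using `‖e‖² / σ ≥ 2 m ‖e‖ - m² σ`; the choice of `m` makes the
    -- integrated form of this the Cauchy-Schwarz inequality `∫ ‖e‖² / σ ≥ N² / (b - a)`
    have hpt : ∀ t ∈ Icc a' b', (ρ ^ 2 - m ^ 2) * σ t +
        (2 * ⟪h (τ t), e t⟫ - ⟪η t, A (e t)⟫) + (2 * m - ‖A‖ * N) * ‖e t‖ ≤ ‖u t‖ / k := by
      intro t ht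
      have p1 : -(‖A‖ * N * ‖e t‖) ≤ ⟪η t, A (e t)⟫ := by
        have h1 := abs_real_inner_le_norm (η t) (A (e t))
        have h2 : ‖η t‖ * ‖A (e t)‖ ≤ N * (‖A‖ * ‖e t‖) :=
          mul_le_mul (hηN t ht) (A.le_opNorm _) (norm_nonneg _) hN0
        have h3 := neg_abs_le ⟪η t, A (e t)⟫
        linarith
      have p2 : ‖u t‖ ^ 2 = σ t ^ 2 * ρ ^ 2 + 2 * σ t * ⟪h (τ t), e t⟫ + ‖e t‖ ^ 2 := by
        have e1 : u t = σ t • h (τ t) + e t := by simp [he]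
        rw [e1, norm_add_sq_real, norm_smul, real_inner_smul_left, hρ, mul_pow, Real.norm_eq_abs,
          sq_abs]
        ring
      have p3 : ‖u t‖ ^ 2 ≤ σ t * (‖u t‖ / k) := by
        have h1 : σ t * (‖u t‖ / k) = (‖u t‖ + δ) * ‖u t‖ := by
          simp only [hσ]; field_simp
        rw [h1]
        nlinarith [norm_nonneg (u t)]
      have p4 : 2 * m * σ t * ‖e t‖ - m ^ 2 * σ t ^ 2 ≤ ‖e t‖ ^ 2 := by
        nlinarith [sq_nonneg (‖e t‖ - m * σ t)]
      refine le_of_mul_le_mul_left ?_ (hσ0 t)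
      have p5 := mul_le_mul_of_nonneg_left p1 (hσ0 t).le
      linarith
    have hint := intervalIntegral.integral_mono_on hab'.le
      (Continuous.intervalIntegrable (μ := volume) (by fun_prop) a' b')
      (Continuous.intervalIntegrable (μ := volume) (by fun_prop) a' b') hpt
    rw [intervalIntegral.integral_add (Continuous.intervalIntegrable (by fun_prop) a' b')
        (Continuous.intervalIntegrable (by fun_prop) a' b'),
      intervalIntegral.integral_add (Continuous.intervalIntegrable (by fun_prop) a' b')
        (Continuous.intervalIntegrable (by fun_prop) a' b'), hΨint,
      intervalIntegral.integral_const_mul, intervalIntegral.integral_const_mul, hσint, ← hN,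
      intervalIntegral.integral_div, ← hL, add_zero] at hint
    have hmb : m * (b - a) = N := by rw [hm]; field_simp
    have hAN : ‖A‖ * N * N ≤ m * N := by
      have h1 : ‖A‖ * N ≤ m := by
        rw [← hmb]
        nlinarith [mul_le_mul_of_nonneg_left hsmall hm0]
      exact mul_le_mul_of_nonneg_right h1 hN0
    have hLk : L / k = L * M / (b - a) := by rw [hk]; field_simp
    rw [hLk, le_div_iff₀ hba] at hint
    have h5 : ρ ^ 2 * (b - a) ≤
        (ρ ^ 2 - m ^ 2) * (b - a) + (2 * m - ‖A‖ * N) * N := by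
      have h6 : m ^ 2 * (b - a) = m * N := by rw [← hmb]; ring
      linarith
    calc (ρ * (b - a)) ^ 2 = ρ ^ 2 * (b - a) * (b - a) := by ring
      _ ≤ _ := mul_le_mul_of_nonneg_right h5 hba.le
      _ ≤ L * M := hint
      _ = _ := by rw [hM]
  refine abs_le_of_sq_le_sq' ?_ hL0 |>.2
  refine le_of_forall_pos_le_add fun ε hε => ?_
  have hδ : 0 < ε / (L * (b' - a') + 1) := by positivity
  refine (main _ hδ).trans ?_
  have h7 : L * (b' - a') * (ε / (L * (b' - a') + 1)) ≤ ε := by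
    rw [← mul_div_assoc, div_le_iff₀ (by positivity)]
    nlinarith [mul_nonneg hL0 hℓ.le]
  nlinarith

end minimality

/-- A curve which is continuously differentiable on a compact interval coincides there with
a curve which is continuously differentiable on the line. -/
theorem exists_hasDerivAt_extension {F : Type*} [NormedAddCommGroup F] [NormedSpace ℝ F]
    [CompleteSpace F] {a b : ℝ} (hab : a < b) {γ : ℝ → F} (hγ : ContDiffOn ℝ ∞ γ (Icc a b)) :
    ∃ g u : ℝ → F, Continuous u ∧ (∀ t, HasDerivAt g (u t) t) ∧
      ∀ t ∈ Icc a b, g t = γ t ∧ u t = derivWithin γ (Icc a b) t := by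
  have hU := uniqueDiffOn_Icc hab
  have hcont : ContinuousOn (derivWithin γ (Icc a b)) (Icc a b) :=
    hγ.continuousOn_derivWithin hU (by simp)
  set u := IccExtend hab.le ((Icc a b).domRestrict (derivWithin γ (Icc a b))) with hu
  have huc : Continuous u := (continuousOn_iff_continuous_domRestrict.1 hcont).Icc_extend'
  have hut : ∀ t ∈ Icc a b, u t = derivWithin γ (Icc a b) t := fun t ht => by
    rw [hu, IccExtend_of_mem hab.le _ ht]
    rfl
  have hg : ∀ t, HasDerivAt (fun t => γ a + ∫ r in a..t, u r) (u t) t := fun t =>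
    (huc.integral_hasStrictDerivAt a t).hasDerivAt.const_add _
  refine ⟨_, u, huc, hg, fun t ht => ⟨?_, hut t ht⟩⟩
  have hd : ∀ s ∈ Icc a b,
      HasDerivWithinAt (fun t => (γ a + ∫ r in a..t, u r) - γ t) 0 (Icc a b) s := by
    intro s hs
    have h1 := ((hγ.differentiableOn (by simp)) s hs).hasDerivWithinAt
    refine ((hg s).hasDerivWithinAt.sub h1).congr_deriv ?_
    rw [hut s hs, sub_self]
  have h2 := eq_of_hasDerivWithinAt_zero ordConnected_Icc hd ht (left_mem_Icc.2 hab.le)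
  simpa [sub_eq_zero] using h2

/-! ### Normal geodesics and curves of class `Q_1` -/

/-- Two curves with the same derivative on an interval which agree at one point are equal. -/
theorem eqOn_of_hasDerivWithinAt {F : Type*} [NormedAddCommGroup F] [NormedSpace ℝ F]
    {f g f' : ℝ → F} {I : Set ℝ} (hI : I.OrdConnected)
    (hf : ∀ s ∈ I, HasDerivWithinAt f (f' s) I s) (hg : ∀ s ∈ I, HasDerivWithinAt g (f' s) I s)
    {s₀ : ℝ} (hs₀ : s₀ ∈ I) (h : f s₀ = g s₀) : EqOn f g I := by
  intro s hs
  have h1 := eq_of_hasDerivWithinAt_zero (f := fun s => f s - g s) hI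
    (fun r hr => ((hf r hr).sub (hg r hr)).congr_deriv (sub_self _)) hs hs₀
  simpa [h, sub_eq_zero] using h1

theorem contDiff_integral {F : Type*} [NormedAddCommGroup F] [NormedSpace ℝ F] [CompleteSpace F]
    {f : ℝ → F} (hf : ContDiff ℝ ∞ f) (a : ℝ) : ContDiff ℝ ∞ (fun s => ∫ r in a..s, f r) := by
  have h : ∀ s, HasDerivAt (fun s => ∫ r in a..s, f r) (f s) s := fun s =>
    (hf.continuous.integral_hasStrictDerivAt a s).hasDerivAt
  rw [contDiff_infty_iff_deriv]
  refine ⟨fun s => (h s).differentiableAt, ?_⟩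
  rwa [show deriv (fun s => ∫ r in a..s, f r) = f from funext fun s => (h s).deriv]

theorem IsQ.derivWithin {E : Type*} [NormedAddCommGroup E] [NormedSpace ℝ E] {I : Set ℝ}
    (hI : IsInterval I) {μ : ℝ → E} (hμ : IsQ 1 I μ) : IsQ 0 I (derivWithin μ I) := by
  refine ⟨hμ.1.derivWithin hI.uniqueDiffOn (by simp), fun j _ => ?_⟩
  obtain ⟨r, hr⟩ := hμ.2 (j + 1) (by lia)
  exact ⟨r, fun s hs => by rw [← hr s hs, iteratedDerivWithin_succ']⟩

theorem hasDerivAt_affine {E : Type*} [NormedAddCommGroup E] [NormedSpace ℝ E] (a b : E) (s : ℝ) :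
    HasDerivAt (fun s : ℝ => a + s • b) b s := by
  simpa using ((hasDerivAt_id s).smul_const b).const_add a

theorem isAffineOn_of_derivWithin_eq {E : Type*} [NormedAddCommGroup E] [NormedSpace ℝ E]
    {I : Set ℝ} (hI : IsInterval I) {μ : ℝ → E} (hμ : IsQ 1 I μ) {a : E}
    (ha : ∀ s ∈ I, derivWithin μ I s = a) : IsAffineOn I μ := by
  obtain ⟨s₀, hs₀⟩ : I.Nonempty := hI.2.mono interior_subset
  refine ⟨μ s₀ - s₀ • a, a, fun s hs => ?_⟩
  refine eqOn_of_hasDerivWithinAt hI.1 (f := μ) (g := fun s => μ s₀ - s₀ • a + s • a)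
    (f' := fun _ => a) (fun s hs => ?_) (fun s _ => ?_) hs₀ (by simp) hs
  · rw [← ha s hs]
    exact (hμ.1.differentiableOn (by simp) s hs).hasDerivWithinAt
  · exact (hasDerivAt_affine _ a s).hasDerivWithinAt

theorem IsQ.of_hasDerivAt {E : Type*} [NormedAddCommGroup E] [NormedSpace ℝ E]
    {μ γ : ℝ → E} (hμ : ∀ s, HasDerivAt μ (γ s) s) (hγ : IsQ 0 univ γ) : IsQ 1 univ μ := by
  have h : deriv μ = γ := funext fun s => (hμ s).deriv
  refine ⟨?_, fun j hj => ?_⟩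
  · rw [contDiffOn_univ, contDiff_infty_iff_deriv, h]
    exact ⟨fun s => (hμ s).differentiableAt, contDiffOn_univ.1 hγ.1⟩
  · obtain ⟨i, rfl⟩ := Nat.exists_eq_add_of_le' hj
    obtain ⟨r, hr⟩ := hγ.2 i (Nat.zero_le i)
    refine ⟨r, fun s hs => ?_⟩
    rw [← hr s hs, iteratedDerivWithin_univ, iteratedDerivWithin_univ, iteratedDeriv_succ', h]

theorem expFlow_eq_of_pow_eq {F : Type*} [NormedAddCommGroup F] [NormedSpace ℝ F] [CompleteSpace F]
    {A B : F →L[ℝ] F} {u : F} (h : ∀ j, (A ^ j) u = (B ^ j) u) (s : ℝ) :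
    expFlow A s u = expFlow B s u := by
  have key : ∀ C : F →L[ℝ] F,
      HasSum (fun n : ℕ => (n.factorial⁻¹ : ℝ) • s ^ n • (C ^ n) u) (expFlow C s u) := by
    intro C
    have h1 := (NormedSpace.exp_series_hasSum_exp' (𝕂 := ℝ) (s • C)).mapL
      (ContinuousLinearMap.apply ℝ F u)
    refine h1.congr_fun fun n => ?_
    simp [smul_pow]
  have h1 := key A
  simp only [h] at h1
  exact h1.unique (key B)

/-- Curves of class `Q_0` are determined by their germs. -/
theorem IsQ.eq_of_eventuallyEq {E : Type*} [NormedAddCommGroup E] [InnerProductSpace ℝ E]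
    [FiniteDimensional ℝ E] {γ₁ γ₂ : ℝ → E} (h₁ : IsQ 0 univ γ₁) (h₂ : IsQ 0 univ γ₂) {s₀ : ℝ}
    (h : γ₁ =ᶠ[𝓝 s₀] γ₂) : γ₁ = γ₂ := by
  have : CompleteSpace E := FiniteDimensional.complete ℝ E
  have key : ∀ {γ : ℝ → E}, IsQ 0 univ γ → ∃ B : E →L[ℝ] E,
      (∀ s, γ s = expFlow B (s - s₀) (γ s₀)) ∧ ∀ j, iteratedDeriv j γ s₀ = (B ^ j) (γ s₀) := by
    intro γ hγ
    obtain ⟨B, -, hB, -⟩ := hγ.exists_skew_operator isInterval_univ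
    simp only [iteratedDerivWithin_univ] at hB
    refine ⟨B, fun s => ?_, fun j => ?_⟩
    · refine eq_expFlow_of_hasDerivWithinAt B ordConnected_univ (fun r hr => ?_) (mem_univ s₀)
        (mem_univ s)
      have h1 := hB 0 r hr
      rw [zero_add, iteratedDeriv_one, iteratedDeriv_zero] at h1
      rw [← h1]
      exact ((contDiffOn_univ.1 hγ.1).differentiable (by simp) r).hasDerivAt.hasDerivWithinAt
    · induction j with
      | zero => simp
      | succ j ih => rw [hB j s₀ (mem_univ _), ih, pow_succ']; rfl
  obtain ⟨B₁, hB₁, hj₁⟩ := key h₁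
  obtain ⟨B₂, hB₂, hj₂⟩ := key h₂
  funext s
  rw [hB₁ s, hB₂ s, ← h.eq_of_nhds]
  refine expFlow_eq_of_pow_eq (fun j => ?_) _
  rw [← hj₁, h.iteratedDeriv_eq, hj₂, h.eq_of_nhds]

namespace StepTwoAlgebra

variable {E : Type*} [NormedAddCommGroup E] [InnerProductSpace ℝ E] [FiniteDimensional ℝ E]
variable {S : StepTwoAlgebra E} {w : E} {A : S.V₁ →L[ℝ] S.V₁}

theorem hasDerivAt_projFirst {s : ℝ} {c : ℝ → S.carrier} {X : S.V₁}
    (hc : HasDerivAt c (S.leftField (S.inclFirst X) (c s)) s) :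
    HasDerivAt (fun s => S.projFirst (c s)) X s := by
  have := S.projFirst.hasFDerivAt.comp_hasDerivAt s hc
  rwa [projFirst_leftField] at this

/-- Horizontal curves are determined by their horizontal velocity and one of their points. -/
theorem IsStructureOperator.eqOn_of_velocity_eq (hA : S.IsStructureOperator w A) (hw : w ∈ S.V₂)
    {c c' : ℝ → S.carrier} {h : ℝ → S.V₁} {J : Set ℝ} (hJ : J.OrdConnected)
    (hc : ∀ s ∈ J, HasDerivAt c (S.leftField (S.inclFirst (h s)) (c s)) s)
    (hc' : ∀ s ∈ J, HasDerivAt c' (S.leftField (S.inclFirst (h s)) (c' s)) s) {s₀ : ℝ}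
    (hs₀ : s₀ ∈ J) (h₀ : c s₀ = c' s₀) : EqOn c c' J := by
  have h1 : EqOn (fun s => S.projFirst (c s)) (fun s => S.projFirst (c' s)) J :=
    eqOn_of_hasDerivWithinAt hJ
      (fun s hs => (hasDerivAt_projFirst (hc s hs)).hasDerivWithinAt)
      (fun s hs => (hasDerivAt_projFirst (hc' s hs)).hasDerivWithinAt) hs₀ (by simp only [h₀])
  refine eqOn_of_hasDerivWithinAt hJ (fun s hs => (hc s hs).hasDerivWithinAt) (fun s hs => ?_)
    hs₀ h₀
  refine (hc' s hs).hasDerivWithinAt.congr_deriv ?_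
  rw [leftField_eq_of_structureOperator hA hw, leftField_eq_of_structureOperator hA hw]
  have h2 := h1 hs
  simp only at h2
  rw [h2]

/-- Twice the vertical coordinate of a point of the group, with respect to the generator `w`. -/
noncomputable def verticalCoord (S : StepTwoAlgebra E) (w : E) : S.carrier →L[ℝ] ℝ :=
  (2 / ⟪w, w⟫) • (innerSL ℝ w ∘L S.carrier.subtypeL)

theorem verticalCoord_leftField (hA : S.IsStructureOperator w A) (hw : w ∈ S.V₂) (hw0 : w ≠ 0)
    (X : S.V₁) (g : S.carrier) :
    S.verticalCoord w (S.leftField (S.inclFirst X) g) = ⟪S.projFirst g, A X⟫ := by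
  have hww : ⟪w, w⟫ ≠ 0 := inner_self_ne_zero.2 hw0
  have h3 : ⟪w, (X : E)⟫ = 0 := (real_inner_comm _ _).trans (S.inner_eq_zero X.2 hw)
  have h4 : S.verticalCoord w (S.leftField (S.inclFirst X) g) =
      2 / ⟪w, w⟫ * ⟪w, (S.leftField (S.inclFirst X) g : E)⟫ := rfl
  rw [h4, leftField_eq_of_structureOperator hA hw, Submodule.coe_add, Submodule.coe_smul,
    inner_add_right, inner_smul_right, coe_inclFirst, h3]
  field_simp
  ring

/-- Trajectories whose velocity rotates by the flow of the structure operator are minimizing on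
short intervals. -/
theorem IsStructureOperator.isMinimizing (hA : S.IsStructureOperator w A) (hw : w ∈ S.V₂)
    (hw0 : w ≠ 0) {c : ℝ → S.carrier} {h : ℝ → S.V₁} (hcs : ContDiff ℝ ∞ c)
    (hc : ∀ s, HasDerivAt c (S.leftField (S.inclFirst (h s)) (c s)) s)
    (hh : ∀ s, HasDerivAt h (A (h s)) s) {a b : ℝ} (hab : a < b) (hsmall : ‖A‖ * (b - a) ≤ 1) :
    S.IsMinimizing a b c := by
  have : CompleteSpace S.V₁ := FiniteDimensional.complete ℝ S.V₁
  have : CompleteSpace S.carrier := FiniteDimensional.complete ℝ S.carrier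
  have hder : ∀ s ∈ Icc a b, derivWithin c (Icc a b) s = S.leftField (S.inclFirst (h s)) (c s) :=
    fun s hs => (hc s).hasDerivWithinAt.derivWithin (uniqueDiffOn_Icc hab s hs)
  have hnorm : ∀ s, ‖h s‖ = ‖h 0‖ := by
    intro s
    have h1 := eq_expFlow_of_hasDerivWithinAt A ordConnected_univ
      (fun s _ => (hh s).hasDerivWithinAt) (mem_univ 0) (mem_univ s)
    rw [h1, norm_expFlow hA.1]
  have hhor : S.IsHorizontalCurve a b c := ⟨hcs.contDiffOn, fun s hs => ⟨h s, hder s hs⟩⟩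
  have hlen : S.length a b c = ‖h 0‖ * (b - a) := by
    have h1 : ∫ s in a..b, ‖S.V₁.starProjection ((derivWithin c (Icc a b) s : S.carrier) : E)‖ =
        ∫ _ in a..b, ‖h 0‖ := by
      refine intervalIntegral.integral_congr fun s hs => ?_
      rw [uIcc_of_le hab.le] at hs
      rw [hder s hs, ← coe_projFirst, projFirst_leftField, ← hnorm s]
      rfl
    rw [length, h1, intervalIntegral.integral_const, smul_eq_mul, mul_comm]
  refine ⟨hhor, le_antisymm ?_ ?_⟩
  · refine le_iInf fun a' => le_iInf fun b' => le_iInf fun γ => le_iInf fun hγ => ?_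
    obtain ⟨hab', ⟨hγs, hγh⟩, hγa, hγb⟩ := hγ
    refine ENNReal.ofReal_le_ofReal ?_
    obtain ⟨g, u, hu, hg, hgγ⟩ := exists_hasDerivAt_extension hab' hγs
    have hlen' : S.length a' b' γ = ∫ t in a'..b', ‖S.projFirst (u t)‖ := by
      refine intervalIntegral.integral_congr fun s hs => ?_
      rw [uIcc_of_le hab'.le] at hs
      rw [← (hgγ s hs).2]
      rfl
    have ha' := hgγ a' (left_mem_Icc.2 hab'.le)
    have hb' := hgγ b' (right_mem_Icc.2 hab'.le)
    rw [hlen, hlen']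
    refine length_trajectory_le hA.1 hab hsmall (x := fun s => S.projFirst (c s)) (h := h)
      (Z := fun s => S.verticalCoord w (c s)) (ξ := fun t => S.projFirst (g t))
      (ζ := fun t => S.verticalCoord w (g t)) (fun s => hasDerivAt_projFirst (hc s)) hh
      (fun s => ?_) hnorm hab' (S.projFirst.continuous.comp hu)
      (fun t => S.projFirst.hasFDerivAt.comp_hasDerivAt t (hg t)) (fun t ht => ?_) ?_ ?_ ?_ ?_
    · have h1 := (S.verticalCoord w).hasFDerivAt.comp_hasDerivAt s (hc s)
      rwa [verticalCoord_leftField hA hw hw0] at h1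
    · obtain ⟨X, hX⟩ := hγh t ht
      have h1 := (S.verticalCoord w).hasFDerivAt.comp_hasDerivAt t (hg t)
      have h2 : u t = S.leftField (S.inclFirst X) (g t) := by
        rw [(hgγ t ht).2, (hgγ t ht).1, hX]
      rw [h2, verticalCoord_leftField hA hw hw0] at h1
      rw [h2, projFirst_leftField]
      exact h1
    · simp only [ha'.1, hγa]
    · simp only [hb'.1, hγb]
    · simp only [ha'.1, hγa]
    · simp only [hb'.1, hγb]
  · exact iInf_le_of_le a (iInf_le_of_le b (iInf_le_of_le c (iInf_le_of_le
      ⟨hab, hhor, rfl, rfl⟩ le_rfl)))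

/-- The horizontal curve with the velocity `exp(sA) v` through a given point. -/
theorem IsStructureOperator.exists_trajectory (hA : S.IsStructureOperator w A) (hw : w ∈ S.V₂)
    (v : S.V₁) (g₀ : S.carrier) (s₀ : ℝ) : ∃ c : ℝ → S.carrier, ContDiff ℝ ∞ c ∧ c s₀ = g₀ ∧
      ∀ s, HasDerivAt c (S.leftField (S.inclFirst (expFlow A s v)) (c s)) s := by
  have : CompleteSpace S.V₁ := FiniteDimensional.complete ℝ S.V₁
  have hh : ContDiff ℝ ∞ (fun s => expFlow A s v) := contDiff_expFlow A v
  set W : S.carrier := ⟨w, S.V₂_le hw⟩ with hW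
  let ι : S.V₁ →L[ℝ] S.carrier :=
    LinearMap.toContinuousLinearMap (Submodule.inclusion S.V₁_le)
  have hι : ∀ x, ι x = S.inclFirst x := fun x => rfl
  obtain ⟨X, hX, hX0, hXd⟩ : ∃ X : ℝ → S.V₁, ContDiff ℝ ∞ X ∧ X s₀ = 0 ∧
      ∀ s, HasDerivAt X (expFlow A s v) s :=
    ⟨fun s => ∫ r in s₀..s, expFlow A r v, contDiff_integral hh s₀, by simp, fun s =>
      (hh.continuous.integral_hasStrictDerivAt s₀ s).hasDerivAt⟩
  obtain ⟨f, hf, hf0, hfd⟩ : ∃ f : ℝ → ℝ, ContDiff ℝ ∞ f ∧ f s₀ = 0 ∧ ∀ s,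
      HasDerivAt f ((1 / 2 : ℝ) * ⟪S.projFirst g₀ + X s, A (expFlow A s v)⟫) s := by
    have hf : ContDiff ℝ ∞
        (fun s => (1 / 2 : ℝ) * ⟪S.projFirst g₀ + X s, A (expFlow A s v)⟫) :=
      contDiff_const.mul ((contDiff_const.add hX).inner ℝ (A.contDiff.comp hh))
    exact ⟨_, contDiff_integral hf s₀, by simp, fun s =>
      (hf.continuous.integral_hasStrictDerivAt s₀ s).hasDerivAt⟩
  refine ⟨fun s => g₀ + ι (X s) + f s • W, ?_, by simp [hX0, hf0], fun s => ?_⟩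
  · exact (contDiff_const.add (ι.contDiff.comp hX)).add (hf.smul contDiff_const)
  · have h0 : HasDerivAt (fun s => ι (X s)) (ι (expFlow A s v)) s :=
      ι.hasFDerivAt.comp_hasDerivAt s (hXd s)
    have h1 := (h0.const_add g₀).fun_add ((hfd s).smul_const W)
    refine h1.congr_deriv ?_
    have h2 : S.projFirst (g₀ + ι (X s) + f s • W) = S.projFirst g₀ + X s := by
      have h3 : S.projFirst W = 0 := S.proj_eq_zero_of_mem_V₂ hw
      have h4 : S.projFirst (ι (X s)) = X s := by
        rw [hι, projFirst_apply, coe_inclFirst]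
        exact Submodule.orthogonalProjectionOnto_mem_subspace_eq_self (X s)
      rw [map_add, map_add, map_smul, h3, h4, smul_zero, add_zero]
    rw [leftField_eq_of_structureOperator hA hw, h2, hι]

theorem IsStructureOperator.isNormalGeodesicAt (hA : S.IsStructureOperator w A) (hw : w ∈ S.V₂)
    (hw0 : w ≠ 0) {c : ℝ → S.carrier} {h : ℝ → S.V₁} (hcs : ContDiff ℝ ∞ c)
    (hc : ∀ s, HasDerivAt c (S.leftField (S.inclFirst (h s)) (c s)) s)
    (hh : ∀ s, HasDerivAt h (A (h s)) s) (s₀ : ℝ) : S.IsNormalGeodesicAt c s₀ := by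
  obtain ⟨p, hp⟩ := hA.exists_bicharacteristic hw hw0 hc hh
  -- intervals `(a, b)` of length less than `2 ε = 1 / (‖A‖ + 1)` are short enough
  refine ⟨1 / (2 * (‖A‖ + 1)), by positivity, fun a b ha hab hb => ?_, p, fun s _ => hp s⟩
  refine hA.isMinimizing hw hw0 hcs hc hh hab ?_
  have h1 : b - a ≤ 1 / (‖A‖ + 1) := by
    have : 1 / (‖A‖ + 1) = 2 * (1 / (2 * (‖A‖ + 1))) := by field_simp
    linarith
  calc ‖A‖ * (b - a) ≤ (‖A‖ + 1) * (1 / (‖A‖ + 1)) :=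
        mul_le_mul (by linarith) h1 (by linarith) (by positivity)
    _ = 1 := by field_simp

theorem proj_add (hw : w ∈ S.V₂) (x : S.V₁) :
    S.V₁.orthogonalProjectionOnto ((x : E) + w) = x :=
  Subtype.ext (S.starProjection_add hw x)

/-- The germ of a normal geodesic with the horizontal projection of a curve of class `Q_1`. -/
theorem IsDeterminedBy.existsUnique_geodesic {I : Set ℝ} (hI : IsInterval I) {μ : ℝ → E}
    (hμ : IsQ 1 I μ) (hne : ¬ IsAffineOn I μ) (hS : S.IsDeterminedBy I (derivWithin μ I))
    {s₀ : ℝ} (hs₀ : s₀ ∈ I) : ∃ c : ℝ → S.carrier,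
      (S.IsNormalGeodesicAt c s₀ ∧ c s₀ = S.carrier.orthogonalProjectionOnto (μ s₀) ∧
        ∀ᶠ s in 𝓝[I] s₀, S.V₁.starProjection (c s : E) = S.V₁.starProjection (μ s)) ∧
      ∀ c' : ℝ → S.carrier,
        (S.IsNormalGeodesicAt c' s₀ ∧ c' s₀ = S.carrier.orthogonalProjectionOnto (μ s₀) ∧
          ∀ᶠ s in 𝓝[I] s₀, S.V₁.starProjection (c' s : E) = S.V₁.starProjection (μ s)) →
        c' =ᶠ[𝓝 s₀] c := by
  have : CompleteSpace S.V₁ := FiniteDimensional.complete ℝ S.V₁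
  obtain ⟨-, -, w, hw, hw0, A, hA, v, hγ⟩ := hS
  have hμd : ∀ s ∈ I, HasDerivWithinAt μ (((expFlow A s v : S.V₁) : E) + w) I s := by
    intro s hs
    rw [← hγ s hs]
    exact (hμ.1.differentiableOn (by simp) s hs).hasDerivWithinAt
  have hh : ∀ s, HasDerivAt (fun s => expFlow A s v) (A (expFlow A s v)) s := hasDerivAt_expFlow A v
  obtain ⟨c, hcs, hc0, hc⟩ :=
    hA.exists_trajectory hw v (S.carrier.orthogonalProjectionOnto (μ s₀)) s₀
  have hproj : ∀ s ∈ I, S.projFirst (c s) = S.V₁.orthogonalProjectionOnto (μ s) := by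
    refine eqOn_of_hasDerivWithinAt hI.1
      (fun s hs => (hasDerivAt_projFirst (hc s)).hasDerivWithinAt)
      (fun s hs => ?_) hs₀ ?_
    · have h1 := S.V₁.orthogonalProjectionOnto.hasFDerivAt.comp_hasDerivWithinAt s (hμd s hs)
      rwa [proj_add hw] at h1
    · rw [hc0]
      exact Submodule.orthogonalProjectionOnto_starProjection_of_le S.V₁_le (μ s₀)
  refine ⟨c, ⟨hA.isNormalGeodesicAt hw hw0 hcs hc hh s₀, hc0, ?_⟩, ?_⟩
  · filter_upwards [self_mem_nhdsWithin] with s hs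
    exact congrArg Subtype.val (hproj s hs)
  rintro c' ⟨⟨ε, hε, -, p, hp⟩, hc0', hproj'⟩
  set J := Ioo (s₀ - ε) (s₀ + ε) with hJ
  have hs₀J : s₀ ∈ J := ⟨by linarith, by linarith⟩
  have hJn : J ∈ 𝓝 s₀ := isOpen_Ioo.mem_nhds hs₀J
  obtain ⟨l, h, hch⟩ := hA.exists_velocity hw ordConnected_Ioo hp
  have hx : ∀ᶠ s in 𝓝[I] s₀, S.projFirst (c' s) = S.projFirst (c s) := by
    filter_upwards [hproj', self_mem_nhdsWithin] with s hs hsI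
    rw [hproj s hsI]
    exact Subtype.ext hs
  -- the horizontal velocities agree on `I` near `s₀`
  have hv : ∀ᶠ s in 𝓝[I] s₀, h s = expFlow A s v := by
    filter_upwards [eventually_eventually_nhdsWithin.2 hx, self_mem_nhdsWithin,
      mem_nhdsWithin_of_mem_nhds hJn] with s hs hsI hsJ
    have h1 := (hasDerivAt_projFirst (hch s hsJ).1).hasDerivWithinAt (s := I)
    have h2 := (hasDerivAt_projFirst (hc s)).hasDerivWithinAt (s := I)
    exact (hI.uniqueDiffOn s hsI).eq_deriv _ h1
      (h2.congr_of_eventuallyEq hs (hs.self_of_nhdsWithin hsI))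
  have hv0 : h s₀ = expFlow A s₀ v := hv.self_of_nhdsWithin hs₀
  -- hence so do the accelerations at `s₀`, even if `s₀` is an end point of `I`
  have hacc : l • A (expFlow A s₀ v) = A (expFlow A s₀ v) := by
    have h1 := (hch s₀ hs₀J).2.hasDerivWithinAt (s := I)
    have h2 := ((hh s₀).hasDerivWithinAt (s := I)).congr_of_eventuallyEq hv hv0
    have h3 := (hI.uniqueDiffOn s₀ hs₀).eq_deriv _ h1 h2
    rwa [hv0] at h3
  have hAv : A (expFlow A s₀ v) ≠ 0 := by
    intro h0
    apply hne
    have h1 : ∀ s, expFlow A s v = expFlow A s₀ v := by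
      intro s
      rw [← sub_add_cancel s s₀, expFlow_add, expFlow_of_apply_eq_zero A h0]
    exact isAffineOn_of_derivWithin_eq hI hμ fun s hs => by rw [hγ s hs, h1 s]
  have hl : l = 1 := by
    by_contra hl
    have h1 : (l - 1) • A (expFlow A s₀ v) = 0 := by rw [sub_smul, hacc, one_smul, sub_self]
    exact (smul_ne_zero (sub_ne_zero.2 hl) hAv) h1
  subst hl
  have hvJ : ∀ s ∈ J, h s = expFlow A s v := by
    intro s hs
    have h1 := eq_expFlow_of_hasDerivWithinAt A ordConnected_Ioo (f := h) (I := J)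
      (fun r hr => by simpa using (hch r hr).2.hasDerivWithinAt) hs₀J hs
    rw [h1, hv0, ← expFlow_add, sub_add_cancel]
  have hfin := hA.eqOn_of_velocity_eq hw ordConnected_Ioo (J := J)
    (fun s hs => by rw [← hvJ s hs]; exact (hch s hs).1) (fun s _ => hc s) hs₀J
    (hc0'.trans hc0.symm)
  exact hfin.eventuallyEq_of_mem hJn

/-- The curves of class `Q_1` which accompany a horizontal curve whose velocity rotates by a flow of
isometries. -/
theorem exists_isCompanion (hA : ∀ x y : S.V₁, ⟪A x, y⟫ = -⟪x, A y⟫) (hw : w ∈ S.V₂)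
    {c : ℝ → S.carrier} {h : ℝ → S.V₁} {s₀ ε : ℝ} (hε : 0 < ε)
    (hch : ∀ s ∈ Ioo (s₀ - ε) (s₀ + ε),
      HasDerivAt c (S.leftField (S.inclFirst (h s)) (c s)) s ∧ HasDerivAt h (A (h s)) s) :
    ∃ μ : ℝ → E, S.IsCompanion c s₀ w μ ∧ ∃ v : S.V₁, ∀ s,
      deriv μ s = ((expFlow A s v : S.V₁) : E) + w := by
  have : CompleteSpace E := FiniteDimensional.complete ℝ E
  have : CompleteSpace S.V₁ := FiniteDimensional.complete ℝ S.V₁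
  set J := Ioo (s₀ - ε) (s₀ + ε) with hJ
  have hs₀J : s₀ ∈ J := ⟨by linarith, by linarith⟩
  set v := expFlow A (-s₀) (h s₀) with hv
  have hvJ : ∀ s ∈ J, h s = expFlow A s v := by
    intro s hs
    rw [eq_expFlow_of_hasDerivWithinAt A ordConnected_Ioo (f := h) (I := J)
      (fun r hr => (hch r hr).2.hasDerivWithinAt) hs₀J hs, hv, ← expFlow_add, sub_eq_add_neg]
  set γ : ℝ → E := fun s => ((expFlow A s v : S.V₁) : E) + w with hγ
  have hγQ : IsQ 0 univ γ := isQ_family hw hA v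
  have hγc : Continuous γ := (contDiffOn_univ.1 hγQ.1).continuous
  have hμ : ∀ s, HasDerivAt (fun s => (c s₀ : E) + ∫ r in s₀..s, γ r) (γ s) s := fun s =>
    (hγc.integral_hasStrictDerivAt s₀ s).hasDerivAt.const_add _
  refine ⟨fun s => (c s₀ : E) + ∫ r in s₀..s, γ r,
    ⟨IsQ.of_hasDerivAt hμ hγQ, by simp, ?_, fun s => ?_⟩, v, fun s => (hμ s).deriv⟩
  · have h1 : EqOn (fun s => S.V₁.orthogonalProjectionOnto ((c s₀ : E) + ∫ r in s₀..s, γ r))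
        (fun s => S.projFirst (c s)) J := by
      refine eqOn_of_hasDerivWithinAt (f' := h) ordConnected_Ioo (fun s hs => ?_)
        (fun s hs => (hasDerivAt_projFirst (hch s hs).1).hasDerivWithinAt) hs₀J ?_
      · have h2 := S.V₁.orthogonalProjectionOnto.hasFDerivAt.comp_hasDerivAt s (hμ s)
        rw [hγ, proj_add hw, ← hvJ s hs] at h2
        exact h2.hasDerivWithinAt
      · simp only [intervalIntegral.integral_same, add_zero]
        rfl
    filter_upwards [isOpen_Ioo.mem_nhds hs₀J] with s hs
    exact congrArg Subtype.val (h1 hs)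
  · rw [(hμ s).deriv]
    exact S.orthogonal_starProjection_add hw _

theorem IsCompanion.eq {c : ℝ → S.carrier} {s₀ : ℝ} {μ₁ μ₂ : ℝ → E}
    (h₁ : S.IsCompanion c s₀ w μ₁) (h₂ : S.IsCompanion c s₀ w μ₂) : μ₁ = μ₂ := by
  have hd : ∀ {μ : ℝ → E}, IsQ 1 univ μ → ∀ s, HasDerivAt μ (deriv μ s) s := fun hμ s =>
    ((contDiffOn_univ.1 hμ.1).differentiable (by simp) s).hasDerivAt
  have hQ : ∀ {μ : ℝ → E}, IsQ 1 univ μ → IsQ 0 univ (deriv μ) := fun hμ => by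
    simpa [derivWithin_univ] using hμ.derivWithin isInterval_univ
  have hx : ∀ᶠ s in 𝓝 s₀, S.V₁.starProjection (μ₁ s) = S.V₁.starProjection (μ₂ s) := by
    filter_upwards [h₁.2.2.1, h₂.2.2.1] with s hs hs'
    rw [hs, hs']
  have hv : deriv μ₁ =ᶠ[𝓝 s₀] deriv μ₂ := by
    filter_upwards [eventually_eventually_nhds.2 hx] with s hs
    have e1 := S.V₁.starProjection.hasFDerivAt.comp_hasDerivAt s (hd h₁.1 s)
    have e2 := S.V₁.starProjection.hasFDerivAt.comp_hasDerivAt s (hd h₂.1 s)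
    have e3 := e1.unique (e2.congr_of_eventuallyEq hs)
    rw [← S.V₁.starProjection_add_starProjection_orthogonal (deriv μ₁ s),
      ← S.V₁.starProjection_add_starProjection_orthogonal (deriv μ₂ s), e3, h₁.2.2.2, h₂.2.2.2]
  have hv' := (hQ h₁.1).eq_of_eventuallyEq (hQ h₂.1) hv
  funext s
  refine eqOn_of_hasDerivWithinAt ordConnected_univ (f' := deriv μ₁)
    (fun s _ => (hd h₁.1 s).hasDerivWithinAt) (fun s _ => ?_) (mem_univ s₀)
    (h₁.2.1.trans h₂.2.1.symm) (mem_univ s)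
  rw [hv']
  exact (hd h₂.1 s).hasDerivWithinAt

theorem existsUnique_isCompanion (hS : S.IsContact) {s₀ : ℝ} {c : ℝ → S.carrier}
    (hc : S.IsNormalGeodesicAt c s₀) (hw : w ∈ S.V₂) : ∃! μ : ℝ → E, S.IsCompanion c s₀ w μ := by
  obtain ⟨w₀, hw₀, hw₀0⟩ := S.V₂.exists_mem_ne_zero_of_ne_bot S.V₂_ne_bot
  obtain ⟨A, hA, -⟩ := existsUnique_isStructureOperator hS hw₀ hw₀0
  obtain ⟨ε, hε, -, p, hp⟩ := hc
  obtain ⟨l, h, hch⟩ := hA.exists_velocity hw₀ ordConnected_Ioo hp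
  have hskew : ∀ x y : S.V₁, ⟪(l • A) x, y⟫ = -⟪x, (l • A) y⟫ := fun x y => by
    rw [smul_apply, smul_apply, real_inner_smul_left, inner_smul_right, hA.1, mul_neg]
  obtain ⟨μ, hμ, -⟩ := exists_isCompanion hskew hw hε hch
  exact ⟨μ, hμ, fun μ' hμ' => hμ'.eq hμ⟩

theorem existsUnique_isCompanion_inFamily (hS : S.IsContact) {s₀ : ℝ} {c : ℝ → S.carrier}
    (hc : S.IsNormalGeodesicAt c s₀)
    (hne : ¬ ∃ a b : E, ∀ᶠ s in 𝓝 s₀, S.V₁.starProjection (c s : E) = a + s • b) :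
    ∃! μ : ℝ → E, ∃ w ∈ S.V₂, w ≠ 0 ∧ S.IsCompanion c s₀ w μ ∧ S.InFamily w univ (deriv μ) := by
  have : CompleteSpace S.V₁ := FiniteDimensional.complete ℝ S.V₁
  obtain ⟨w₀, hw₀, hw₀0⟩ := S.V₂.exists_mem_ne_zero_of_ne_bot S.V₂_ne_bot
  obtain ⟨A, hA, -⟩ := existsUnique_isStructureOperator hS hw₀ hw₀0
  obtain ⟨ε, hε, -, p, hp⟩ := hc
  obtain ⟨l, h, hch⟩ := hA.exists_velocity hw₀ ordConnected_Ioo hp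
  set J := Ioo (s₀ - ε) (s₀ + ε) with hJ
  have hs₀J : s₀ ∈ J := ⟨by linarith, by linarith⟩
  have hJn : J ∈ 𝓝 s₀ := isOpen_Ioo.mem_nhds hs₀J
  have hskew : ∀ x y : S.V₁, ⟪(l • A) x, y⟫ = -⟪x, (l • A) y⟫ := fun x y => by
    rw [smul_apply, smul_apply, real_inner_smul_left, inner_smul_right, hA.1, mul_neg]
  have hacc : (l • A) (h s₀) ≠ 0 := by
    intro h0
    apply hne
    have h1 : ∀ s ∈ J, h s = h s₀ := by
      intro s hs
      rw [eq_expFlow_of_hasDerivWithinAt (l • A) ordConnected_Ioo (f := h) (I := J)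
        (fun r hr => (hch r hr).2.hasDerivWithinAt) hs₀J hs, expFlow_of_apply_eq_zero _ h0]
    have h2 : EqOn (fun s => S.projFirst (c s))
        (fun s => S.projFirst (c s₀) - s₀ • h s₀ + s • h s₀) J := by
      refine eqOn_of_hasDerivWithinAt (f' := fun _ => h s₀) ordConnected_Ioo (fun s hs => ?_)
        (fun s hs => ?_) hs₀J (by simp)
      · rw [← h1 s hs]
        exact (hasDerivAt_projFirst (hch s hs).1).hasDerivWithinAt
      · exact (hasDerivAt_affine _ (h s₀) s).hasDerivWithinAt
    refine ⟨((S.projFirst (c s₀) - s₀ • h s₀ : S.V₁) : E), ((h s₀ : S.V₁) : E), ?_⟩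
    filter_upwards [hJn] with s hs
    exact congrArg Subtype.val (h2 hs)
  have hl : l ≠ 0 := fun h0 => hacc (by simp [h0])
  -- the generator with respect to which the structure operator is `l • A`
  set w := l⁻¹ • w₀ with hw
  have hwV : w ∈ S.V₂ := S.V₂.smul_mem _ hw₀
  have hw0 : w ≠ 0 := smul_ne_zero (inv_ne_zero hl) hw₀0
  have hAw : S.IsStructureOperator w (l • A) := ⟨hskew, fun x y => by
    rw [hA.2, hw, smul_apply, inner_smul_right, smul_smul]
    congr 1
    field_simp⟩
  obtain ⟨μ, hμ, v, hv⟩ := exists_isCompanion hskew hwV hε hch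
  refine ⟨μ, ⟨w, hwV, hw0, hμ, l • A, hAw, v, fun s _ => hv s⟩, ?_⟩
  rintro μ' ⟨w', hwV', hw0', hμ', A', hA', v', hv'⟩
  -- the acceleration of the horizontal projection of `c` at `s₀` determines the generator
  suffices hww : w' = w by
    subst hww
    exact hμ'.eq hμ
  -- the horizontal velocity of `μ'` is that of `c`
  have hd : ∀ s, HasDerivAt μ' (deriv μ' s) s := fun s =>
    ((contDiffOn_univ.1 hμ'.1.1).differentiable (by simp) s).hasDerivAt
  have hx : ∀ᶠ s in 𝓝 s₀, S.projFirst (c s) = S.V₁.orthogonalProjectionOnto (μ' s) := by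
    filter_upwards [hμ'.2.2.1] with s hs
    exact Subtype.ext hs.symm
  have hvel : ∀ᶠ s in 𝓝 s₀, h s = expFlow A' s v' := by
    filter_upwards [eventually_eventually_nhds.2 hx, hJn] with s hs hsJ
    have e1 := S.V₁.orthogonalProjectionOnto.hasFDerivAt.comp_hasDerivAt s (hd s)
    rw [hv' s (mem_univ s), proj_add hwV'] at e1
    exact (hasDerivAt_projFirst (hch s hsJ).1).unique (e1.congr_of_eventuallyEq hs)
  have hacc' : (l • A) (h s₀) = A' (h s₀) := by
    have e1 := (hasDerivAt_expFlow A' v' s₀).congr_of_eventuallyEq hvel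
    rw [← hvel.self_of_nhds] at e1
    exact (hch s₀ hs₀J).2.unique e1
  obtain ⟨t, rfl⟩ : ∃ t : ℝ, t • w = w' := by
    rw [← Submodule.mem_span_singleton, ← V₂_eq_span hS hwV hw0]
    exact hwV'
  have hAA : t • A' (h s₀) = (l • A) (h s₀) := by
    refine ext_inner_left ℝ fun x => ?_
    have e1 := (hAw.2 x (h s₀)).symm.trans (hA'.2 x (h s₀))
    rw [smul_smul ⟪x, A' (h s₀)⟫] at e1
    rw [inner_smul_right, mul_comm]
    exact (smul_left_injective ℝ hw0 e1).symm
  have ht : (t - 1) • (l • A) (h s₀) = 0 := by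
    rw [sub_smul, one_smul, sub_eq_zero]
    rwa [← hacc'] at hAA
  have ht1 : t = 1 := by
    by_contra hne1
    exact smul_ne_zero (sub_ne_zero.2 hne1) hacc ht
  rw [ht1, one_smul]

end StepTwoAlgebra

theorem theorem1 (d : ℕ) :
    -- (a) from curves of class `Q_0` to algebras
    (∀ (I : Set ℝ) (γ : ℝ → EuclideanSpace ℝ (Fin d)),
      IsInterval I → IsQ 0 I γ → ¬ IsConstantOn I γ → LiesInHyperplaneOffOrigin I γ →
      ∃! S : StepTwoAlgebra (EuclideanSpace ℝ (Fin d)), S.IsDeterminedBy I γ) ∧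
    -- (a) from algebras to families of curves of class `Q_0`
    (∀ S : StepTwoAlgebra (EuclideanSpace ℝ (Fin d)), S.IsContact →
      ∀ w ∈ S.V₂, w ≠ 0 →
        (∃! A : S.V₁ →L[ℝ] S.V₁, S.IsStructureOperator w A) ∧
        ∀ v ∈ S.V₁, ∃! γ : ℝ → EuclideanSpace ℝ (Fin d),
          IsQ 0 univ γ ∧ S.InFamily w univ γ ∧ S.V₁.starProjection (γ 0) = v) ∧
    -- (b) from curves of class `Q_1` to algebras and germs of normal geodesics
    (∀ (I : Set ℝ) (μ : ℝ → EuclideanSpace ℝ (Fin d)),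
      IsInterval I → IsQ 1 I μ → ¬ IsAffineOn I μ →
      LiesInHyperplaneOffOrigin I (derivWithin μ I) →
      (∃! S : StepTwoAlgebra (EuclideanSpace ℝ (Fin d)), S.IsDeterminedBy I (derivWithin μ I)) ∧
      ∀ S : StepTwoAlgebra (EuclideanSpace ℝ (Fin d)), S.IsDeterminedBy I (derivWithin μ I) →
        ∀ s₀ ∈ I, ∃ c : ℝ → S.carrier,
          (S.IsNormalGeodesicAt c s₀ ∧ c s₀ = S.carrier.orthogonalProjectionOnto (μ s₀) ∧
            ∀ᶠ s in 𝓝[I] s₀, S.V₁.starProjection (c s : EuclideanSpace ℝ (Fin d)) =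
              S.V₁.starProjection (μ s)) ∧
          ∀ c' : ℝ → S.carrier,
            (S.IsNormalGeodesicAt c' s₀ ∧ c' s₀ = S.carrier.orthogonalProjectionOnto (μ s₀) ∧
              ∀ᶠ s in 𝓝[I] s₀, S.V₁.starProjection (c' s : EuclideanSpace ℝ (Fin d)) =
                S.V₁.starProjection (μ s)) →
            c' =ᶠ[𝓝 s₀] c) ∧
    -- (b) from algebras and germs of normal geodesics to curves of class `Q_1`
    (∀ S : StepTwoAlgebra (EuclideanSpace ℝ (Fin d)), S.IsContact →
      ∀ (s₀ : ℝ) (c : ℝ → S.carrier), S.IsNormalGeodesicAt c s₀ →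
        (∀ w ∈ S.V₂, ∃! μ : ℝ → EuclideanSpace ℝ (Fin d), S.IsCompanion c s₀ w μ) ∧
        ((¬ ∃ a b : EuclideanSpace ℝ (Fin d), ∀ᶠ s in 𝓝 s₀,
            S.V₁.starProjection (c s : EuclideanSpace ℝ (Fin d)) = a + s • b) →
          ∃! μ : ℝ → EuclideanSpace ℝ (Fin d), ∃ w ∈ S.V₂, w ≠ 0 ∧
            S.IsCompanion c s₀ w μ ∧ S.InFamily w univ (deriv μ))) := by
  exact ⟨fun I γ hI hγ hne hhyp => StepTwoAlgebra.existsUnique_isDeterminedBy hI hγ hne hhyp,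
    fun S hS w hw hw0 => ⟨StepTwoAlgebra.existsUnique_isStructureOperator hS hw hw0,
      fun v hv => StepTwoAlgebra.existsUnique_inFamily hS hw hw0 hv⟩,
    fun I μ hI hμ hne hhyp => ⟨StepTwoAlgebra.existsUnique_isDeterminedBy hI (hμ.derivWithin hI)
        (fun ⟨a, ha⟩ => hne (isAffineOn_of_derivWithin_eq hI hμ ha)) hhyp,
      fun S hS s₀ hs₀ => hS.existsUnique_geodesic hI hμ hne hs₀⟩,
    fun S hS s₀ c hc => ⟨fun w hw => StepTwoAlgebra.existsUnique_isCompanion hS hc hw,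
      fun hne => StepTwoAlgebra.existsUnique_isCompanion_inFamily hS hc hne⟩⟩
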